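/- **Theorem 5.3.** Let $S$ and $T$ be finite disjoint sets and let $E^*$ be the edge set of the complete bipartite graph with colour classes $S$ and $T$. Let $G_0=(S,T;E_0)$, $E_0\subseteq E^*$, be a simple bipartite graph. For a bipartite graph $G=(S,T;F)$ and $X\subseteq T$ let $\Gamma_G(X)\subseteq S$ be the set of vertices of $S$ having a neighbour in $X$; for $F\subseteq E^*$ let $d_F(v)$ be the number of edges of $F$ incident with the vertex $v$. Let $p_T:2^T\to\mathbb Z$ be positively intersecting supermodular, i.e. $p_T(X)+p_T(Y)\le p_T(X\cup Y)+p_T(X\cap Y)$ whenever $X\cap Y$, $X\setminus Y$, $Y\setminus X$ are all nonempty and $p_T(X),p_T(Y)>0$; and assume $p_T\le |S|$. We say that $G$ *covers* $p_T$ if $|\Gamma_G(X)|\ge p_T(X)$ for all $\emptyset\ne X\subseteq T$. Let $\{S_1,\dots,S_l\}$ be a partition of $S$ into nonempty classes, let $f_1,f_2:\{1,\dots,l\}\to\mathbb N$ satisfy $f_1\le f_2$, and let $g:T\to\mathbb N$, where $0\in\mathbb N$. For $S'\subseteq S$ and $t\in T$ put $\overline{S'}=S\setminus S'$ and $g_{S'}(t)=\min\{|S'\setminus\Gamma_{G_0}(\{t\})|,\,g(t)\}$;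 for $h:T\to\mathbb N$ and $X\subseteq T$ put $\widetilde h(X)=\sum_{t\in X}h(t)$. There exists $E\subseteq E^*$ such that - (i) the graph $G^+=(S,T;E\cup E_0)$ is simple (i.e. $E\cap E_0=\emptyset$) and covers $p_T$, - (ii) $f_1(\alpha)\le\sum_{s\in S_\alpha}d_E(s)\le f_2(\alpha)$ for $1\le\alpha\le l$, - (iii) $d_E(t)\le g(t)$ for $t\in T$, if and only if for all $n\ge 0$, all pairwise disjoint nonempty $T_1,\dots,T_n\subseteq T$ and every $S_0\subseteq S$ that is the union of some (possibly none) of $S_1,\dots,S_l$, $$\sum_{j=1}^n\bigl(|\overline{S_0}\cup\Gamma_{G_0}(T_j)|+\widetilde g(T_j)\bigr)\ \ge\ \sum_{j=1}^n p_T(T_j)+\sum_{S_\alpha\subseteq\overline{S_0}}f_1(\alpha)-\widetilde{g}_{\overline{S_0}}\Bigl(T\setminus\bigcup_{j=1}^nT_j\Bigr)\qquad(40)$$ and $$\sum_{j=1}^n\bigl(p_T(T_j)-|\overline{S_0}\cup\Gamma_{G_0}(T_j)|\bigr)\ \le\ \sum_{S_\alpha\subseteq S_0}f_2(\alpha).\qquad(42)$$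 In particular, for $n=0$, (40) implies $\widetilde g_{\overline{S_0}}(T)\ge\sum_{S_\alpha\subseteq\overline{S_0}}f_1(\alpha)$. Matroidal version: let moreover $M_S$ be a matroid with ground set $S$ and rank function $r_S$. Then there exists $E\subseteq E^*$ satisfying (ii), (iii) and - (i') $G^+=(S,T;E\cup E_0)$ is simple (i.e. $E\cap E_0=\emptyset$) and $r_S(\Gamma_{G^+}(X))\ge p_T(X)$ for all $\emptyset\ne X\subseteq T$, if and only if, for all $n$, $T_1,\dots,T_n$ and $S_0$ as above, (40) and (42) hold with $|\overline{S_0}\cup\Gamma_{G_0}(T_j)|$ replaced by $r_S(\overline{S_0}\cup\Gamma_{G_0}(T_j))$. -/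

import Mathlib

/-!
A simple bipartite graph with colour classes `S` and `T` is given by its edge set, a
`Finset (S × T)`; the set `E*` of all edges of the complete bipartite graph is `Finset.univ`.
Since `E` and `E₀` are both subsets of `E*`, the graph with edge set `E ∪ E₀` (edges of `E` being
added to those of `E₀`) is simple if and only if no edge of `E` is parallel to an edge of `E₀`,
that is, if and only if `E` and `E₀` are disjoint.
-/

namespace BipCover

section

variable {S T : Type*} [Fintype S] [DecidableEq S] [Fintype T] [DecidableEq T]

/-- `Γ_G(X)`: the set of vertices in `S` that have a neighbour in `X ⊆ T`. -/
def nbr (E : Finset (S × T)) (X : Finset T) : Finset S :=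
  Finset.univ.filter fun s => ∃ t ∈ X, (s, t) ∈ E

/-- `d_E(s)`, the number of edges of `E` incident with `s ∈ S`. -/
def degS (E : Finset (S × T)) (s : S) : ℕ := (E.filter fun e => e.1 = s).card

/-- `d_E(t)`, the number of edges of `E` incident with `t ∈ T`. -/
def degT (E : Finset (S × T)) (t : T) : ℕ := (E.filter fun e => e.2 = t).card

/-- `X` and `Y` are properly intersecting. -/
def ProperlyIntersecting (X Y : Finset T) : Prop :=
  (X ∩ Y).Nonempty ∧ (X \ Y).Nonempty ∧ (Y \ X).Nonempty

/-- `p` is positively intersecting supermodular. -/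
def PosIntersectingSupermodular (p : Finset T → ℤ) : Prop :=
  ∀ X Y : Finset T, ProperlyIntersecting X Y → 0 < p X → 0 < p Y →
    p X + p Y ≤ p (X ∪ Y) + p (X ∩ Y)

/-- The graph with edge set `E` covers `p`, sizes of subsets of `S` being measured by `ρ`.
For `ρ = Finset.card` this is ordinary covering; for the rank function `ρ` of a matroid on `S`
it is covering with respect to that matroid. -/
def Covers (ρ : Finset S → ℕ) (E : Finset (S × T)) (p : Finset T → ℤ) : Prop :=
  ∀ X : Finset T, X.Nonempty → p X ≤ (ρ (nbr E X) : ℤ)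

/-- The rank function of a matroid, on finite sets (where the rank is finite). -/
noncomputable def rank (M : Matroid S) (X : Finset S) : ℕ := (M.eRk (X : Set S)).toNat

/-- `P` is (an enumeration of) a partition of `S` into nonempty classes. -/
def IsPartition {l : ℕ} (P : Fin l → Finset S) : Prop :=
  (∀ α, (P α).Nonempty) ∧ (∀ α β, α ≠ β → Disjoint (P α) (P β)) ∧
    Finset.univ.biUnion P = Finset.univ

/-- `S₀` is the union of some (possibly none, possibly all) of the sets `P 0, …, P (l - 1)`. -/
def IsUnionOfParts {l : ℕ} (P : Fin l → Finset S) (S₀ : Finset S) : Prop :=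
  ∃ A : Finset (Fin l), S₀ = A.biUnion P

/-- `X 0, …, X (n - 1)` are pairwise disjoint nonempty subsets of `T`. -/
def IsDisjointFamily {n : ℕ} (X : Fin n → Finset T) : Prop :=
  (∀ j, (X j).Nonempty) ∧ ∀ i j, i ≠ j → Disjoint (X i) (X j)

/-- `g_{S₁}(t) = min {|S₁ \ Γ_{G₀}(t)|, g(t)}`. -/
def gRestrict (E₀ : Finset (S × T)) (g : T → ℕ) (S₁ : Finset S) (t : T) : ℕ :=
  min (S₁ \ nbr E₀ {t}).card (g t)

/-- `E` is a set of new edges such that `E ∪ E₀` is simple and covers `p` (with respect to `ρ`),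
`f₁(α) ≤ ∑_{s ∈ P_α} d_E(s) ≤ f₂(α)` for all `α`, and `d_E(t) ≤ g(t)` for all `t ∈ T`. -/
def IsGoodAugmentation (ρ : Finset S → ℕ) (E₀ : Finset (S × T)) (p : Finset T → ℤ) {l : ℕ}
    (P : Fin l → Finset S) (f₁ f₂ : Fin l → ℕ) (g : T → ℕ) (E : Finset (S × T)) : Prop :=
  (Disjoint E E₀ ∧ Covers ρ (E ∪ E₀) p) ∧
  (∀ α, f₁ α ≤ ∑ s ∈ P α, degS E s ∧ ∑ s ∈ P α, degS E s ≤ f₂ α) ∧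
  (∀ t, degT E t ≤ g t)

/-- The inequality involving the lower bounds `f₁`, for `S₀ ⊆ S` and `X 0, …, X (n - 1) ⊆ T`. -/
def LowerIneq (ρ : Finset S → ℕ) (E₀ : Finset (S × T)) (p : Finset T → ℤ) {l : ℕ}
    (P : Fin l → Finset S) (f₁ : Fin l → ℕ) (g : T → ℕ)
    {n : ℕ} (X : Fin n → Finset T) (S₀ : Finset S) : Prop :=
  (∑ j, p (X j)) + (∑ α with P α ⊆ S₀ᶜ, (f₁ α : ℤ))
      - (∑ t ∈ Finset.univ \ Finset.univ.biUnion X, (gRestrict E₀ g S₀ᶜ t : ℤ))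
    ≤ ∑ j, ((ρ (S₀ᶜ ∪ nbr E₀ (X j)) : ℤ) + ∑ t ∈ X j, (g t : ℤ))

/-- The inequality involving the upper bounds `f₂`, for `S₀ ⊆ S` and `X 0, …, X (n - 1) ⊆ T`. -/
def UpperIneq (ρ : Finset S → ℕ) (E₀ : Finset (S × T)) (p : Finset T → ℤ) {l : ℕ}
    (P : Fin l → Finset S) (f₂ : Fin l → ℕ)
    {n : ℕ} (X : Fin n → Finset T) (S₀ : Finset S) : Prop :=
  ∑ j, (p (X j) - (ρ (S₀ᶜ ∪ nbr E₀ (X j)) : ℤ)) ≤ ∑ α with P α ⊆ S₀, (f₂ α : ℤ)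

end

end BipCover

/-!
Add a sink `none` to `S` and let each `t ∈ T` have degree exactly `g t`, the sink absorbing whatever
is not used. Coverage, simplicity and the degrees in `T` then become one demand `q X Y`, a lower
bound on the number of edges between `X ⊆ T` and `Y ⊆ S ∪ {none}`, which satisfies a supermodular
inequality for pairs whose first coordinates meet. Uncrossing shows that the largest total demand
towards `Y` of a disjoint family is supermodular in `Y`. Hence (40) and (42), which say that this
function of unions of classes is compatible with the bounds on the degrees, allow degree sums of the
classes that dominate it and add up to `∑ t, g t`.

For such degree sums the edges can be chosen one at a time, as in the proof of Edmonds' theorem on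
disjoint branchings. Given `t` with positive demand, call a set of classes critical if its degrees
are used up by a disjoint family with a member `X ∋ t`, and look at those critical sets that contain
a class lying in no set of classes used up by a family avoiding `t`. Critical sets with such a class
in common uncross, so a minimal one, with `X` maximal, contains a vertex `k` such that an edge from
`k` to `t` meets one unit of the demand of `X` for every critical set containing the class of `k`.
-/

namespace BipCover

open Finset

/-! ### Uncrossing families of demands -/

section Demands

variable {T K : Type*} {q : Finset T → Finset K → ℤ} {F F' : Finset (Finset T)}
  {A A' B B' V V' W W' Z : Finset T} {Y Y' Y₁ Y₂ : Finset K} {β β' : ℤ}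

/-- A family of pairwise disjoint sets, each with positive demand towards `Y`. -/
structure IsPosFamily (q : Finset T → Finset K → ℤ) (Y : Finset K) (F : Finset (Finset T)) :
    Prop where
  disjoint : (F : Set (Finset T)).PairwiseDisjoint id
  pos : ∀ X ∈ F, 0 < q X Y

theorem IsPosFamily.subset (hF : IsPosFamily q Y F) (h : F' ⊆ F) : IsPosFamily q Y F' :=
  ⟨hF.disjoint.subset (coe_subset.2 h), fun X hX => hF.pos X (h hX)⟩

variable [DecidableEq T]

theorem disjoint_biUnion_erase (hF : (F : Set (Finset T)).PairwiseDisjoint id) (hA : A ∈ F) :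
    Disjoint A ((F.erase A).biUnion id) := by
  rw [disjoint_biUnion_right]
  exact fun B hB => hF hA (mem_of_mem_erase hB) (ne_of_mem_erase hB).symm

theorem biUnion_eq_union_biUnion_erase (hA : A ∈ F) :
    F.biUnion id = A ∪ (F.erase A).biUnion id := by
  conv_lhs => rw [← insert_erase hA, biUnion_insert, id]

theorem pairwiseDisjoint_insert_of_disjoint_biUnion (hF : (F : Set (Finset T)).PairwiseDisjoint id)
    (hB : Disjoint B (F.biUnion id)) :
    ((insert B F : Finset (Finset T)) : Set (Finset T)).PairwiseDisjoint id := by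
  rw [coe_insert]
  exact hF.insert fun A hA _ => (disjoint_biUnion_right ..).1 hB A hA

/-- The outcome of uncrossing: `β` units of demand are found on one disjoint family `M`, towards
`Y₁`, and another one `N`, towards `Y₂`. Here `V` and `W` bound the extent of `M` and `N`, and `B`
is a distinguished set which either lies inside one member of `M` or is avoided by `M`, in the
sense that `M` stays inside `V`; for `B = ∅` this last condition is void. -/
def Uncrossable (q : Finset T → Finset K → ℤ) (Y₁ Y₂ : Finset K) (B V W : Finset T) (β : ℤ) :
    Prop :=
  ∃ M N : Finset (Finset T), (M : Set (Finset T)).PairwiseDisjoint id ∧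
    (N : Set (Finset T)).PairwiseDisjoint id ∧ M.biUnion id ⊆ B ∪ V ∧
    ((∃ C ∈ M, B ⊆ C) ∨ M.biUnion id ⊆ V) ∧ N.biUnion id ⊆ W ∧
    β ≤ ∑ X ∈ M, q X Y₁ + ∑ X ∈ N, q X Y₂

namespace Uncrossable

theorem mono (h : Uncrossable q Y₁ Y₂ B V W β) (hB : B' ⊆ B) (hBV : B ∪ V ⊆ B' ∪ V') (hV : V ⊆ V')
    (hW : W ⊆ W') (hβ : β' ≤ β) : Uncrossable q Y₁ Y₂ B' V' W' β' := by
  obtain ⟨M, N, hM, hN, hMB, hMV, hNW, hle⟩ := h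
  exact ⟨M, N, hM, hN, hMB.trans hBV,
    hMV.imp (fun ⟨C, hC, hBC⟩ => ⟨C, hC, hB.trans hBC⟩) (fun h => h.trans hV), hNW.trans hW,
    hβ.trans hle⟩

theorem of_empty (h : Uncrossable q Y₁ Y₂ ∅ V W β) : Uncrossable q Y₁ Y₂ B V W β := by
  obtain ⟨M, N, hM, hN, hMV, -, hNW, hle⟩ := h
  rw [empty_union] at hMV
  exact ⟨M, N, hM, hN, hMV.trans subset_union_right, Or.inr hMV, hNW, hle⟩

end Uncrossable

variable [DecidableEq K]

/-- A demand: `q X Y` is the number of edges that must join `X` to `Y`. The supermodularity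
condition for a crossing pair intersects and unites the two coordinates in opposite ways. Demands
are normalised to be nonnegative, with no demand on `∅`, so that an empty set in a family is
harmless. -/
structure IsDemand (q : Finset T → Finset K → ℤ) : Prop where
  nonneg : ∀ X Y, 0 ≤ q X Y
  empty : ∀ Y, q ∅ Y = 0
  mono : ∀ X, Monotone (q X)
  add_le : ∀ {X X' : Finset T} {Y Y' : Finset K}, (X ∩ X').Nonempty → 0 < q X Y → 0 < q X' Y' →
    q X Y + q X' Y' ≤ q (X ∪ X') (Y ∩ Y') + q (X ∩ X') (Y ∪ Y')

theorem IsDemand.nonempty_of_pos (hq : IsDemand q) (hB : 0 < q B Y) : B.Nonempty := by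
  rw [nonempty_iff_ne_empty]
  rintro rfl
  exact hB.ne' (hq.empty Y)

theorem IsDemand.add_sum_le_sum_insert (hq : IsDemand q) (hB : Disjoint B (F.biUnion id)) :
    q B Y + ∑ X ∈ F, q X Y ≤ ∑ X ∈ insert B F, q X Y := by
  by_cases h : B ∈ F
  · have : B = ∅ := disjoint_self_iff_empty B |>.1 ((disjoint_biUnion_right ..).1 hB B h)
    rw [insert_eq_of_mem h, this, hq.empty, zero_add]
  · rw [sum_insert h]

namespace Uncrossable

theorem insert_left (hq : IsDemand q) (h : Uncrossable q Y₁ Y₂ ∅ V W β) (hB : Disjoint B V) :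
    Uncrossable q Y₁ Y₂ B V W (β + q B Y₁) := by
  obtain ⟨M, N, hM, hN, hMV, -, hNW, hle⟩ := h
  rw [empty_union] at hMV
  have hBM := hB.mono_right hMV
  refine ⟨insert B M, N, pairwiseDisjoint_insert_of_disjoint_biUnion hM hBM, hN, ?_,
    Or.inl ⟨B, mem_insert_self B M, Subset.rfl⟩, hNW, ?_⟩
  · rw [biUnion_insert, id]
    exact union_subset_union_right hMV
  · linarith [hq.add_sum_le_sum_insert (Y := Y₁) hBM]

theorem insert_right (hq : IsDemand q) (h : Uncrossable q Y₁ Y₂ B V W β) (hA : Disjoint A W) :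
    Uncrossable q Y₁ Y₂ B V (A ∪ W) (β + q A Y₂) := by
  obtain ⟨M, N, hM, hN, hMB, hMV, hNW, hle⟩ := h
  have hAN := hA.mono_right hNW
  refine ⟨M, insert A N, hM, pairwiseDisjoint_insert_of_disjoint_biUnion hN hAN, hMB, hMV, ?_, ?_⟩
  · rw [biUnion_insert, id]
    exact union_subset_union_right hNW
  · linarith [hq.add_sum_le_sum_insert (Y := Y₂) hAN]

theorem of_meets_member (hq : IsDemand q) (hF : IsPosFamily q Y F) (hA : A ∈ F) (hY₁ : Y₁ ⊆ Y)
    (hY₂ : Y ⊆ Y₂) (hB : 0 < q B Y₁) (hBA : (B ∩ A).Nonempty) (hBZ : Disjoint B (F.biUnion id ∩ Z))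
    (h : Uncrossable q Y₁ Y₂ (B ∪ A) ((F.erase A).biUnion id ∪ Z) ((F.erase A).biUnion id ∪ Z)
      (∑ X ∈ F.erase A, q X Y + β + q (B ∪ A) Y₁)) :
    Uncrossable q Y₁ Y₂ B (F.biUnion id ∪ Z) (F.biUnion id ∪ Z)
      (∑ X ∈ F, q X Y + β + q B Y₁) := by
  have hdisj : Disjoint (B ∩ A) ((F.erase A).biUnion id ∪ Z) := by
    refine disjoint_union_right.2 ⟨?_, ?_⟩
    · exact (disjoint_biUnion_erase hF.disjoint hA).mono_left inter_subset_right
    · rw [disjoint_left] at hBZ ⊢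
      intro t ht htZ
      obtain ⟨htB, htA⟩ := mem_inter.1 ht
      exact hBZ htB (mem_inter.2 ⟨mem_biUnion.2 ⟨A, hA, htA⟩, htZ⟩)
  have hcov := biUnion_eq_union_biUnion_erase hA
  have hadd := hq.add_le hBA hB (hF.pos A hA)
  rw [inter_eq_left.2 hY₁, union_eq_right.2 hY₁] at hadd
  have hsum := add_sum_erase F (fun X => q X Y) hA
  refine (h.insert_right hq hdisj).mono subset_union_left ?_ ?_ ?_ ?_
  · rw [hcov, union_assoc, union_assoc]
  · exact union_subset_union_left (hcov ▸ subset_union_right)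
  · rw [hcov, ← union_assoc]
    exact union_subset_union_left (union_subset_union_left inter_subset_right)
  · linarith [hq.mono (B ∩ A) hY₂]

theorem of_crossing_members (hq : IsDemand q) (hF : IsPosFamily q Y F) (hF' : IsPosFamily q Y' F')
    (hA : A ∈ F) (hA' : A' ∈ F') (hAA' : (A ∩ A').Nonempty) (hV : V =
      (F.erase A).biUnion id ∪ (F'.erase A').biUnion id)
    (h : Uncrossable q (Y ∩ Y') (Y ∪ Y') (A ∪ A') V V
      (∑ X ∈ F.erase A, q X Y + ∑ X ∈ F'.erase A', q X Y' + q (A ∪ A') (Y ∩ Y'))) :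
    Uncrossable q (Y ∩ Y') (Y ∪ Y') (A ∪ A') V ((A ∩ A') ∪ V)
      (∑ X ∈ F, q X Y + ∑ X ∈ F', q X Y') := by
  have hdisj : Disjoint (A ∩ A') V := hV ▸ disjoint_union_right.2
    ⟨(disjoint_biUnion_erase hF.disjoint hA).mono_left inter_subset_left,
      (disjoint_biUnion_erase hF'.disjoint hA').mono_left inter_subset_right⟩
  have hsum := add_sum_erase F (fun X => q X Y) hA
  have hsum' := add_sum_erase F' (fun X => q X Y') hA'
  exact (h.insert_right hq hdisj).mono Subset.rfl Subset.rfl Subset.rfl Subset.rfl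
    (by linarith [hq.add_le hAA' (hF.pos A hA) (hF'.pos A' hA')])

theorem of_disjoint (hq : IsDemand q) (hF : IsPosFamily q Y F) (hF' : IsPosFamily q Y' F')
    (h : ∀ A ∈ F, ∀ A' ∈ F', Disjoint A A') :
    Uncrossable q (Y ∩ Y') (Y ∪ Y') ∅ (F.biUnion id ∪ F'.biUnion id)
      (F.biUnion id ∪ F'.biUnion id) (∑ X ∈ F, q X Y + ∑ X ∈ F', q X Y') := by
  have hFF' : Disjoint F F' := disjoint_left.2 fun A hA hA' =>
    (hq.nonempty_of_pos (hF.pos A hA)).ne_empty ((disjoint_self_iff_empty A).1 (h A hA A hA'))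
  refine ⟨∅, F ∪ F', by simp, ?_, by simp, Or.inr (by simp), union_biUnion.subset, ?_⟩
  · rw [coe_union]
    exact hF.disjoint.union hF'.disjoint fun A hA A' hA' _ => h A hA A' hA'
  · rw [sum_empty, zero_add, sum_union hFF']
    exact add_le_add (sum_le_sum fun X _ => hq.mono X subset_union_left)
      (sum_le_sum fun X _ => hq.mono X subset_union_right)

theorem empty_of_erase (hq : IsDemand q) (hF : IsPosFamily q Y F) (hF' : IsPosFamily q Y' F')
    (h : ∀ A ∈ F, ∀ A' ∈ F', Uncrossable q (Y ∩ Y') (Y ∪ Y') (A ∪ A')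
      ((F.erase A).biUnion id ∪ (F'.erase A').biUnion id)
      ((F.erase A).biUnion id ∪ (F'.erase A').biUnion id)
      (∑ X ∈ F.erase A, q X Y + ∑ X ∈ F'.erase A', q X Y' + q (A ∪ A') (Y ∩ Y'))) :
    Uncrossable q (Y ∩ Y') (Y ∪ Y') ∅ (F.biUnion id ∪ F'.biUnion id)
      (F.biUnion id ∪ F'.biUnion id) (∑ X ∈ F, q X Y + ∑ X ∈ F', q X Y') := by
  by_cases hdisj : ∀ A ∈ F, ∀ A' ∈ F', Disjoint A A'
  · exact of_disjoint hq hF hF' hdisj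
  push Not at hdisj
  obtain ⟨A, hA, A', hA', hAA'⟩ := hdisj
  have hcov := biUnion_eq_union_biUnion_erase hA
  have hcov' := biUnion_eq_union_biUnion_erase hA'
  refine (of_crossing_members hq hF hF' hA hA' (not_disjoint_iff_nonempty_inter.1 hAA') rfl
    (h A hA A' hA')).mono (empty_subset _) ?_ ?_ ?_ le_rfl <;> rw [hcov, hcov'] <;> grind

end Uncrossable

theorem disjoint_union_inter_biUnion_erase (hF : (F : Set (Finset T)).PairwiseDisjoint id)
    (hA : A ∈ F) (hB : Disjoint B (F.biUnion id ∩ Z)) :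
    Disjoint (B ∪ A) ((F.erase A).biUnion id ∩ Z) :=
  disjoint_union_left.2 ⟨hB.mono_right (inter_subset_inter_right
    (biUnion_subset_biUnion_of_subset_left _ (erase_subset A F))),
    (disjoint_biUnion_erase hF hA).mono_right inter_subset_left⟩

theorem disjoint_union_inter_biUnion_erase_erase (hF : (F : Set (Finset T)).PairwiseDisjoint id)
    (hF' : (F' : Set (Finset T)).PairwiseDisjoint id) (hA : A ∈ F) (hA' : A' ∈ F') :
    Disjoint (A ∪ A') ((F.erase A).biUnion id ∩ (F'.erase A').biUnion id) :=
  disjoint_union_left.2 ⟨(disjoint_biUnion_erase hF hA).mono_right inter_subset_left,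
    (disjoint_biUnion_erase hF' hA').mono_right inter_subset_right⟩

theorem IsDemand.uncrossable (hq : IsDemand q) (hF : IsPosFamily q Y F) (hF' : IsPosFamily q Y' F')
    (hB : Disjoint B (F.biUnion id ∩ F'.biUnion id)) :
    Uncrossable q (Y ∩ Y') (Y ∪ Y') B (F.biUnion id ∪ F'.biUnion id)
      (F.biUnion id ∪ F'.biUnion id) (∑ X ∈ F, q X Y + ∑ X ∈ F', q X Y' + q B (Y ∩ Y')) := by
  induction hn : #F + #F' using Nat.strong_induction_on generalizing F F' B with
  | _ n ih =>
  have uncross_empty := Uncrossable.empty_of_erase hq hF hF' fun A hA A' hA' =>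
    ih _ (by linarith [card_erase_lt_of_mem hA, card_erase_lt_of_mem hA'])
      (hF.subset (erase_subset A F)) (hF'.subset (erase_subset A' F'))
      (disjoint_union_inter_biUnion_erase_erase hF.disjoint hF'.disjoint hA hA') rfl
  rcases (hq.nonneg B (Y ∩ Y')).eq_or_lt with hB0 | hBpos
  · rw [← hB0, add_zero]
    exact uncross_empty.of_empty
  by_cases hBF : ∀ A ∈ F, Disjoint B A
  · by_cases hBF' : ∀ A ∈ F', Disjoint B A
    · exact uncross_empty.insert_left hq (disjoint_union_right.2
        ⟨(disjoint_biUnion_right ..).2 hBF, (disjoint_biUnion_right ..).2 hBF'⟩)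
    push Not at hBF'
    obtain ⟨A, hA, hBA⟩ := hBF'
    rw [inter_comm (F.biUnion id)] at hB
    rw [union_comm (F.biUnion id), add_comm (∑ X ∈ F, q X Y)]
    refine Uncrossable.of_meets_member hq hF' hA inter_subset_right subset_union_right hBpos
      (not_disjoint_iff_nonempty_inter.1 hBA) hB ?_
    rw [union_comm _ (F.biUnion id), add_comm _ (∑ X ∈ F, q X Y)]
    exact ih _ (by linarith [card_erase_lt_of_mem hA]) hF (hF'.subset (erase_subset A F'))
      (inter_comm (F.biUnion id) _ ▸ disjoint_union_inter_biUnion_erase hF'.disjoint hA hB) rfl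
  · push Not at hBF
    obtain ⟨A, hA, hBA⟩ := hBF
    exact Uncrossable.of_meets_member hq hF hA inter_subset_left subset_union_left hBpos
      (not_disjoint_iff_nonempty_inter.1 hBA) hB
      (ih _ (by linarith [card_erase_lt_of_mem hA]) (hF.subset (erase_subset A F)) hF'
        (disjoint_union_inter_biUnion_erase hF.disjoint hA hB) rfl)

theorem IsDemand.uncrossable_of_members (hq : IsDemand q) (hF : IsPosFamily q Y F)
    (hF' : IsPosFamily q Y' F') (hA : A ∈ F) (hA' : A' ∈ F') (hAA' : (A ∩ A').Nonempty) :
    Uncrossable q (Y ∩ Y') (Y ∪ Y') (A ∪ A')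
      ((F.erase A).biUnion id ∪ (F'.erase A').biUnion id)
      ((A ∩ A') ∪ ((F.erase A).biUnion id ∪ (F'.erase A').biUnion id))
      (∑ X ∈ F, q X Y + ∑ X ∈ F', q X Y') :=
  Uncrossable.of_crossing_members hq hF hF' hA hA' hAA' rfl
    (hq.uncrossable (hF.subset (erase_subset A F)) (hF'.subset (erase_subset A' F'))
      (disjoint_union_inter_biUnion_erase_erase hF.disjoint hF'.disjoint hA hA'))

end Demands

section MaxDemand

variable {T K : Type*} {q : Finset T → Finset K → ℤ} {F : Finset (Finset T)}
  {W W' X X' : Finset T} {Y Y' : Finset K} {t : T}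

open Classical in
/-- The largest total demand towards `Y` of a family of pairwise disjoint subsets of `W`. -/
noncomputable def maxDemand (q : Finset T → Finset K → ℤ) (W : Finset T) (Y : Finset K) : ℤ :=
  (W.powerset.powerset.filter fun F : Finset (Finset T) =>
    (F : Set (Finset T)).PairwiseDisjoint id).sup' ⟨∅, by simp⟩ fun F => ∑ X ∈ F, q X Y

theorem maxDemand_nonneg : 0 ≤ maxDemand q W Y :=
  le_sup'_of_le _ (b := ∅) (by simp) sum_empty.ge

variable [DecidableEq T]

theorem mem_powerset_powerset_iff : F ∈ W.powerset.powerset ↔ F.biUnion id ⊆ W := by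
  simp only [mem_powerset, subset_iff (s₁ := F), biUnion_subset, id]

theorem sum_le_maxDemand (hF : (F : Set (Finset T)).PairwiseDisjoint id) (hW : F.biUnion id ⊆ W) :
    ∑ X ∈ F, q X Y ≤ maxDemand q W Y := by
  classical
  exact le_sup' (fun F => ∑ X ∈ F, q X Y) (mem_filter.2 ⟨mem_powerset_powerset_iff.2 hW, hF⟩)

theorem sum_le_add_maxDemand_compl [Fintype T] (hF : (F : Set (Finset T)).PairwiseDisjoint id)
    (hX : X ∈ F) : ∑ Z ∈ F, q Z Y ≤ q X Y + maxDemand q Xᶜ Y := by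
  rw [← add_sum_erase F (fun Z => q Z Y) hX]
  gcongr
  exact sum_le_maxDemand (hF.subset (coe_subset.2 (erase_subset X F)))
    (subset_compl_iff_disjoint_left.2 (disjoint_biUnion_erase hF hX))

variable [DecidableEq K]

namespace IsDemand

theorem exists_sum_eq_maxDemand (hq : IsDemand q) (W : Finset T) (Y : Finset K) :
    ∃ F, IsPosFamily q Y F ∧ F.biUnion id ⊆ W ∧ ∑ X ∈ F, q X Y = maxDemand q W Y := by
  classical
  obtain ⟨F, hF, hmax⟩ := exists_mem_eq_sup' (s := W.powerset.powerset.filter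
    fun F : Finset (Finset T) => (F : Set (Finset T)).PairwiseDisjoint id) ⟨∅, by simp⟩
    fun F => ∑ X ∈ F, q X Y
  obtain ⟨hFW, hdisj⟩ := mem_filter.1 hF
  have hpos : F.filter (fun X => 0 < q X Y) ⊆ F := filter_subset _ F
  refine ⟨F.filter fun X => 0 < q X Y, ⟨hdisj.subset (coe_subset.2 hpos),
    fun X hX => (mem_filter.1 hX).2⟩, (biUnion_subset_biUnion_of_subset_left _ hpos).trans
    (mem_powerset_powerset_iff.1 hFW), ?_⟩
  rw [sum_filter_of_ne fun X _ hX => (hq.nonneg X Y).lt_of_ne' hX]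
  exact hmax.symm

theorem maxDemand_le_of_subset (hq : IsDemand q) (hW : W ⊆ W') (hY : Y ⊆ Y') :
    maxDemand q W Y ≤ maxDemand q W' Y' := by
  obtain ⟨F, hF, hFW, hsum⟩ := hq.exists_sum_eq_maxDemand W Y
  rw [← hsum]
  exact (sum_le_sum fun X _ => hq.mono X hY).trans (sum_le_maxDemand hF.disjoint (hFW.trans hW))

theorem maxDemand_add_maxDemand_le (hq : IsDemand q) (W : Finset T) (Y Y' : Finset K) :
    maxDemand q W Y + maxDemand q W Y' ≤ maxDemand q W (Y ∩ Y') + maxDemand q W (Y ∪ Y') := by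
  obtain ⟨F, hF, hFW, hsum⟩ := hq.exists_sum_eq_maxDemand W Y
  obtain ⟨F', hF', hFW', hsum'⟩ := hq.exists_sum_eq_maxDemand W Y'
  obtain ⟨M, N, hM, hN, hMW, -, hNW, hle⟩ := hq.uncrossable hF hF' (disjoint_empty_left _)
  rw [hq.empty, add_zero, hsum, hsum'] at hle
  have hW := union_subset hFW hFW'
  rw [empty_union] at hMW
  exact hle.trans (add_le_add (sum_le_maxDemand hM (hMW.trans hW))
    (sum_le_maxDemand hN (hNW.trans hW)))

variable [Fintype T]

theorem exists_mem_sum_eq_add_maxDemand (hq : IsDemand q) (hX : 0 < q X Y) :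
    ∃ F, IsPosFamily q Y F ∧ X ∈ F ∧ ∑ Z ∈ F, q Z Y = q X Y + maxDemand q Xᶜ Y := by
  obtain ⟨F, hF, hFX, hsum⟩ := hq.exists_sum_eq_maxDemand Xᶜ Y
  have hdisj : Disjoint X (F.biUnion id) := disjoint_compl_right.mono_right hFX
  have hXF : X ∉ F := fun h => (hq.nonempty_of_pos hX).ne_empty
    ((disjoint_self_iff_empty X).1 ((disjoint_biUnion_right ..).1 hdisj X h))
  refine ⟨insert X F, ⟨pairwiseDisjoint_insert_of_disjoint_biUnion hF.disjoint hdisj, ?_⟩,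
    mem_insert_self X F, by rw [sum_insert hXF, hsum]⟩
  rintro Z hZ
  rcases mem_insert.1 hZ with rfl | hZ
  exacts [hX, hF.pos Z hZ]

theorem add_maxDemand_compl_le (hq : IsDemand q) (X : Finset T) (Y : Finset K) :
    q X Y + maxDemand q Xᶜ Y ≤ maxDemand q univ Y := by
  obtain ⟨F, hF, hFX, hsum⟩ := hq.exists_sum_eq_maxDemand Xᶜ Y
  have hdisj : Disjoint X (F.biUnion id) := disjoint_compl_right.mono_right hFX
  rw [← hsum]
  exact (hq.add_sum_le_sum_insert hdisj).trans
    (sum_le_maxDemand (pairwiseDisjoint_insert_of_disjoint_biUnion hF.disjoint hdisj)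
      (subset_univ _))

theorem maxDemand_compl_singleton_le_or (hq : IsDemand q) (ht : t ∈ X) (hX : 0 < q X Y)
    (Y' : Finset K) :
    maxDemand q {t}ᶜ Y' ≤ maxDemand q Xᶜ Y' ∨
      q X Y + maxDemand q Xᶜ Y + maxDemand q {t}ᶜ Y' ≤
        maxDemand q univ (Y ∩ Y') + maxDemand q {t}ᶜ (Y ∪ Y') := by
  obtain ⟨F, hF, hXF, hsum⟩ := hq.exists_mem_sum_eq_add_maxDemand hX
  obtain ⟨F', hF', hFt, hsum'⟩ := hq.exists_sum_eq_maxDemand {t}ᶜ Y'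
  by_cases hdisj : ∀ A ∈ F', Disjoint X A
  · left
    rw [← hsum']
    exact sum_le_maxDemand hF'.disjoint
      (subset_compl_iff_disjoint_left.2 ((disjoint_biUnion_right ..).2 hdisj))
  push Not at hdisj
  obtain ⟨A, hA, hXA⟩ := hdisj
  have htF' : t ∉ F'.biUnion id := subset_compl_singleton.1 hFt
  have htA : t ∉ A := fun h => htF' (mem_biUnion.2 ⟨A, hA, h⟩)
  have htF : t ∉ (F.erase X).biUnion id :=
    disjoint_left.1 (disjoint_biUnion_erase hF.disjoint hXF) ht
  have htF'A : t ∉ (F'.erase A).biUnion id :=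
    fun h => htF' (biUnion_subset_biUnion_of_subset_left _ (erase_subset A F') h)
  obtain ⟨M, N, hM, hN, -, -, hNW, hle⟩ :=
    hq.uncrossable_of_members hF hF' hXF hA (not_disjoint_iff_nonempty_inter.1 hXA)
  right
  rw [← hsum, ← hsum']
  refine hle.trans (add_le_add (sum_le_maxDemand hM (subset_univ _)) (sum_le_maxDemand hN ?_))
  rw [subset_compl_singleton]
  intro htN
  simpa [htA, htF, htF'A] using hNW htN

theorem exists_superset_or_avoiding (hq : IsDemand q) (ht : t ∈ X) (ht' : t ∈ X') (hX : 0 < q X Y)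
    (hX' : 0 < q X' Y') :
    (∃ C, X ∪ X' ⊆ C ∧ q X Y + maxDemand q Xᶜ Y + (q X' Y' + maxDemand q X'ᶜ Y') ≤
      q C (Y ∩ Y') + maxDemand q Cᶜ (Y ∩ Y') + maxDemand q univ (Y ∪ Y')) ∨
    q X Y + maxDemand q Xᶜ Y + (q X' Y' + maxDemand q X'ᶜ Y') ≤
      maxDemand q {t}ᶜ (Y ∩ Y') + maxDemand q univ (Y ∪ Y') := by
  obtain ⟨F, hF, hXF, hsum⟩ := hq.exists_mem_sum_eq_add_maxDemand hX
  obtain ⟨F', hF', hXF', hsum'⟩ := hq.exists_mem_sum_eq_add_maxDemand hX'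
  obtain ⟨M, N, hM, hN, -, hMV, -, hle⟩ :=
    hq.uncrossable_of_members hF hF' hXF hXF' ⟨t, mem_inter.2 ⟨ht, ht'⟩⟩
  rw [hsum, hsum'] at hle
  have hNle := sum_le_maxDemand (q := q) (Y := Y ∪ Y') hN (subset_univ _)
  rcases hMV with ⟨C, hCM, hC⟩ | hMV
  · left
    exact ⟨C, hC, by linarith [sum_le_add_maxDemand_compl (q := q) (Y := Y ∩ Y') hM hCM]⟩
  · right
    have hMt : M.biUnion id ⊆ {t}ᶜ := by
      rw [subset_compl_singleton]
      intro htM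
      rcases mem_union.1 (hMV htM) with h | h
      · exact disjoint_left.1 (disjoint_biUnion_erase hF.disjoint hXF) ht h
      · exact disjoint_left.1 (disjoint_biUnion_erase hF'.disjoint hXF') ht' h
    linarith [sum_le_maxDemand (q := q) (Y := Y ∩ Y') hM hMt]

end IsDemand

end MaxDemand

section SetFunctions

variable {I : Type*} [DecidableEq I]

/-- Supermodularity of an integer-valued set function. -/
def Supermodular (b : Finset I → ℤ) : Prop :=
  ∀ A B, b A + b B ≤ b (A ∩ B) + b (A ∪ B)

theorem sum_sub_single {m : I → ℕ} {i : I} (hi : 0 < m i) (A : Finset I) :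
    ∑ j ∈ A, ((m - Pi.single i 1 : I → ℕ) j : ℤ) =
      ∑ j ∈ A, (m j : ℤ) - if i ∈ A then 1 else 0 := by
  rw [eq_sub_iff_add_eq, ← sum_pi_single i (fun _ => (1 : ℤ)) A, ← sum_add_distrib]
  refine sum_congr rfl fun j _ => ?_
  rcases eq_or_ne j i with rfl | hj
  · simp only [Pi.sub_apply, Pi.single_eq_same]
    omega
  · simp [hj]

variable {b : Finset I → ℤ} {m : I → ℕ}

theorem Supermodular.exists_isGreatest_tight [Finite I] (hb : Supermodular b) (h₀ : 0 ≤ b ∅)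
    (hm : ∀ A, b A ≤ ∑ i ∈ A, (m i : ℤ)) :
    ∃ A₀, IsGreatest {A | ∑ i ∈ A, (m i : ℤ) ≤ b A} A₀ := by
  classical
  cases nonempty_fintype I
  have hunion : ∀ A, ∑ i ∈ A, (m i : ℤ) ≤ b A → ∀ B, ∑ i ∈ B, (m i : ℤ) ≤ b B →
      ∑ i ∈ A ∪ B, (m i : ℤ) ≤ b (A ∪ B) := by
    intro A hA B hB
    linarith [hb A B, hm (A ∩ B), sum_union_inter (s₁ := A) (s₂ := B) (f := fun i => (m i : ℤ))]
  refine ⟨(univ.filter fun A => ∑ i ∈ A, (m i : ℤ) ≤ b A).sup id, ?_, fun A hA => ?_⟩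
  · exact sup_induction (p := fun A => ∑ i ∈ A, (m i : ℤ) ≤ b A) (by simpa using h₀) hunion
      fun A hA => (mem_filter.1 hA).2
  · exact le_sup (f := id) (mem_filter.2 ⟨mem_univ A, hA⟩)

theorem Supermodular.exists_dominating [Fintype I] (hb : Supermodular b) (h₀ : 0 ≤ b ∅)
    {lo hi : I → ℕ} {G : ℕ} (hle : lo ≤ hi) (hG : G ≤ ∑ i, hi i)
    (hhi : ∀ A, b A ≤ ∑ i ∈ A, (hi i : ℤ)) (hlo : ∀ A, b A + ∑ i ∈ Aᶜ, (lo i : ℤ) ≤ G) :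
    ∃ m : I → ℕ, lo ≤ m ∧ m ≤ hi ∧ ∑ i, m i = G ∧ ∀ A, b A ≤ ∑ i ∈ A, (m i : ℤ) := by
  obtain ⟨m, ⟨hlom, hmhi, hGm, hbm⟩, hmin⟩ := exists_minimal_of_wellFoundedLT
    (fun m : I → ℕ => lo ≤ m ∧ m ≤ hi ∧ G ≤ ∑ i, m i ∧ ∀ A, b A ≤ ∑ i ∈ A, (m i : ℤ))
    ⟨hi, hle, le_rfl, hG, hhi⟩
  refine ⟨m, hlom, hmhi, hGm.antisymm' (not_lt.1 fun hlt => ?_), hbm⟩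
  obtain ⟨A₀, htight, hgreatest⟩ := hb.exists_isGreatest_tight h₀ hbm
  have eq_lo_of_notMem : ∀ i ∉ A₀, m i = lo i := by
    intro i hi₀
    refine (hlom i).antisymm' (not_lt.1 fun hi => ?_)
    have hpos := (Nat.zero_le _).trans_lt hi
    have hnot : ¬ m ≤ m - Pi.single i 1 := fun h => by
      have := h i
      simp only [Pi.sub_apply, Pi.single_eq_same] at this
      omega
    refine hnot (hmin ⟨fun j => ?_, tsub_le_self.trans hmhi, ?_, fun A => ?_⟩ tsub_le_self)
    · rcases eq_or_ne j i with rfl | hj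
      · simpa using Nat.le_sub_one_of_lt hi
      · simpa [hj] using hlom j
    · have := sum_sub_single hpos univ
      rw [if_pos (mem_univ i)] at this
      zify at hlt ⊢
      linarith
    · rw [sum_sub_single hpos]
      split_ifs with hiA
      · exact Int.le_sub_one_of_lt (not_le.1 fun h => hi₀ (hgreatest h hiA))
      · simpa using hbm A
  have hsum : ∑ i, (m i : ℤ) = ∑ i ∈ A₀, (m i : ℤ) + ∑ i ∈ A₀ᶜ, (lo i : ℤ) := by
    rw [← sum_add_sum_compl A₀]
    congr 1
    exact sum_congr rfl fun i hi => by rw [eq_lo_of_notMem i (mem_compl.1 hi)]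
  have htight' : ∑ i ∈ A₀, (m i : ℤ) ≤ b A₀ := htight
  zify at hlt
  linarith [hlo A₀]

end SetFunctions

/-! ### Choosing one edge -/

section EdgeSelection

variable {T K I : Type*} [DecidableEq T]

section Residual

variable [DecidableEq K] {q : Finset T → Finset K → ℤ}

theorem IsDemand.le_sdiff (hq : IsDemand q) {X : Finset T} {Y Z : Finset K} (hpos : 0 < q X Y)
    (hZ : ∀ k ∈ Z, q X Y ≤ q X (Y.erase k)) : q X Y ≤ q X (Y \ Z) := by
  induction Z using Finset.induction_on with
  | empty => simp
  | insert k Z _ ih =>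
    have hsdiff := ih fun k' hk' => hZ k' (mem_insert_of_mem hk')
    have herase := hZ k (mem_insert_self k Z)
    have hadd := hq.add_le (X := X) (X' := X) (Y := Y \ Z) (Y' := Y.erase k)
      (by simpa using hq.nonempty_of_pos hpos) (by linarith) (by linarith)
    have hunion := hq.mono X (union_subset (sdiff_subset (s := Y) (t := Z)) (erase_subset k Y))
    rw [union_self, inter_self, show Y \ Z ∩ Y.erase k = Y \ insert k Z by grind] at hadd
    linarith

/-- The demand that remains after an edge from `k` to `t` has been chosen. -/
def residual (q : Finset T → Finset K → ℤ) (t : T) (k : K) (X : Finset T) (Y : Finset K) : ℤ :=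
  if t ∈ X ∧ k ∈ Y then max (q X Y - 1) (q X (Y.erase k)) else q X Y

theorem residual_le (hq : IsDemand q) (t : T) (k : K) (X : Finset T) (Y : Finset K) :
    residual q t k X Y ≤ q X Y := by
  unfold residual
  split_ifs
  · exact max_le (by linarith) (hq.mono X (erase_subset k Y))
  · exact le_rfl

theorem sub_ite_le_residual (hq : IsDemand q) (t : T) (k : K) (X : Finset T) {Y Y' : Finset K}
    (h : Y ⊆ Y') : q X Y - (if t ∈ X ∧ k ∈ Y then 1 else 0) ≤ residual q t k X Y' := by
  have hmono := hq.mono X h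
  unfold residual
  split_ifs with hY hY' hY'
  · exact le_max_of_le_left (by linarith)
  · exact absurd ⟨hY.1, h hY.2⟩ hY'
  · have herase := hq.mono X (subset_erase.2 ⟨h, fun hk => hY ⟨hY'.1, hk⟩⟩)
    exact le_max_of_le_right (by linarith)
  · linarith

theorem exists_residual_eq_sub_ite (q : Finset T → Finset K → ℤ) (t : T) (k : K) (X : Finset T)
    (Y : Finset K) :
    ∃ Y₀ ⊆ Y, residual q t k X Y = q X Y₀ - (if t ∈ X ∧ k ∈ Y₀ then 1 else 0) := by
  unfold residual
  by_cases h : t ∈ X ∧ k ∈ Y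
  · rw [if_pos h]
    rcases max_choice (q X Y - 1) (q X (Y.erase k)) with h' | h' <;> rw [h']
    · exact ⟨Y, Subset.rfl, by rw [if_pos h]⟩
    · exact ⟨Y.erase k, erase_subset k Y, by simp⟩
  · exact ⟨Y, Subset.rfl, by simp [h]⟩

theorem IsDemand.residual (hq : IsDemand q) (t : T) (k : K) : IsDemand (residual q t k) where
  nonneg X Y := by
    unfold BipCover.residual
    split_ifs
    · exact le_max_of_le_right (hq.nonneg X _)
    · exact hq.nonneg X Y
  empty Y := by simp [BipCover.residual, hq.empty]
  mono X Y Y' h := by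
    obtain ⟨Y₀, hY₀, heq⟩ := exists_residual_eq_sub_ite q t k X Y
    rw [heq]
    exact sub_ite_le_residual hq t k X (hY₀.trans h)
  add_le {X X' Y Y'} hne hpos hpos' := by
    obtain ⟨Y₀, hY₀, heq⟩ := exists_residual_eq_sub_ite q t k X Y
    obtain ⟨Y₁, hY₁, heq'⟩ := exists_residual_eq_sub_ite q t k X' Y'
    rw [heq] at hpos ⊢
    rw [heq'] at hpos' ⊢
    have hite : ∀ p : Prop, ∀ [Decidable p], (0 : ℤ) ≤ if p then 1 else 0 := by
      intro p _; split_ifs <;> norm_num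
    have hadd := hq.add_le hne (by linarith [hite (t ∈ X ∧ k ∈ Y₀)] : 0 < q X Y₀)
      (by linarith [hite (t ∈ X' ∧ k ∈ Y₁)] : 0 < q X' Y₁)
    have hunion := sub_ite_le_residual hq t k (X ∪ X') (inter_subset_inter hY₀ hY₁)
    have hinter := sub_ite_le_residual hq t k (X ∩ X') (union_subset_union hY₀ hY₁)
    have hcount : ((if t ∈ X ∪ X' ∧ k ∈ Y₀ ∩ Y₁ then 1 else 0) +
        (if t ∈ X ∩ X' ∧ k ∈ Y₀ ∪ Y₁ then 1 else 0) : ℤ) ≤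
        (if t ∈ X ∧ k ∈ Y₀ then 1 else 0) + (if t ∈ X' ∧ k ∈ Y₁ then 1 else 0) := by
      simp only [mem_union, mem_inter]
      by_cases hX : t ∈ X <;> by_cases hX' : t ∈ X' <;> by_cases hY : k ∈ Y₀ <;>
        by_cases hY' : k ∈ Y₁ <;> simp [hX, hX', hY, hY']
    linarith

end Residual

variable [Fintype K] [DecidableEq I]

/-- The union of the classes with index in `A`, for the partition of `K` into the fibres of `c`. -/
def classUnion (c : K → I) (A : Finset I) : Finset K :=
  univ.filter fun k => c k ∈ A

theorem mem_classUnion {c : K → I} {A : Finset I} {k : K} : k ∈ classUnion c A ↔ c k ∈ A := by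
  simp [classUnion]

theorem classUnion_mono (c : K → I) : Monotone (classUnion c) := fun _ _ h _ hk =>
  mem_classUnion.2 (h (mem_classUnion.1 hk))

theorem classUnion_univ [Fintype I] (c : K → I) : classUnion c univ = univ := by
  ext; simp [mem_classUnion]

theorem classUnion_inter [DecidableEq K] (c : K → I) (A A' : Finset I) :
    classUnion c (A ∩ A') = classUnion c A ∩ classUnion c A' := by
  ext; simp [mem_classUnion]

theorem classUnion_union [DecidableEq K] (c : K → I) (A A' : Finset I) :
    classUnion c (A ∪ A') = classUnion c A ∪ classUnion c A' := by
  ext; simp [mem_classUnion]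

theorem IsDemand.supermodular_maxDemand [DecidableEq K] {q : Finset T → Finset K → ℤ}
    (hq : IsDemand q) (W : Finset T) (c : K → I) :
    Supermodular fun A => maxDemand q W (classUnion c A) := by
  intro A A'
  simpa only [classUnion_inter, classUnion_union] using
    hq.maxDemand_add_maxDemand_le W (classUnion c A) (classUnion c A')

variable [Fintype T] {q : Finset T → Finset K → ℤ} {c : K → I} {m : I → ℕ} {t : T} {k : K}
  {A A' A₀ A₁ : Finset I} {X X' X₁ : Finset T}

/-- The degree bounds `m` on the classes leave room for every family of disjoint demands. -/
def Fits (q : Finset T → Finset K → ℤ) (c : K → I) (m : I → ℕ) : Prop :=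
  ∀ A, maxDemand q univ (classUnion c A) ≤ ∑ i ∈ A, (m i : ℤ)

/-- The sets of classes whose degree bounds are used up by a family of demands avoiding `t`. -/
def avoidingTight (q : Finset T → Finset K → ℤ) (c : K → I) (m : I → ℕ) (t : T) :
    Set (Finset I) :=
  {A | ∑ i ∈ A, (m i : ℤ) ≤ maxDemand q {t}ᶜ (classUnion c A)}

theorem mem_avoidingTight :
    A ∈ avoidingTight q c m t ↔ ∑ i ∈ A, (m i : ℤ) ≤ maxDemand q {t}ᶜ (classUnion c A) :=
  Iff.rfl

/-- The degree bounds on the classes in `A` are used up by a family of demands in which `X`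
is the member that contains `t`. -/
structure IsCritical (q : Finset T → Finset K → ℤ) (c : K → I) (m : I → ℕ) (t : T) (A : Finset I)
    (X : Finset T) : Prop where
  mem : t ∈ X
  pos : 0 < q X (classUnion c A)
  le : ∑ i ∈ A, (m i : ℤ) ≤ q X (classUnion c A) + maxDemand q Xᶜ (classUnion c A)

theorem isCritical_univ_singleton [Fintype I] (ht : 0 < q {t} univ)
    (hfull : ∑ i, (m i : ℤ) ≤ ∑ t, q {t} univ) : IsCritical q c m t univ {t} := by
  rw [← classUnion_univ c] at ht hfull
  refine ⟨mem_singleton_self t, ht, ?_⟩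
  have hdisj : ((univ.map ⟨singleton, singleton_injective⟩ : Finset (Finset T)) :
      Set (Finset T)).PairwiseDisjoint id := by
    rintro _ hX _ hX' hne
    simp only [coe_map, Function.Embedding.coeFn_mk, coe_univ, Set.image_univ, Set.mem_range]
      at hX hX'
    obtain ⟨u, rfl⟩ := hX
    obtain ⟨v, rfl⟩ := hX'
    exact disjoint_singleton.2 fun h => hne (h ▸ rfl)
  have hsum := sum_le_add_maxDemand_compl (q := q) (Y := classUnion c univ) (X := {t}) hdisj
    (mem_map.2 ⟨t, mem_univ t, rfl⟩)
  rw [sum_map] at hsum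
  exact hfull.trans hsum

variable [DecidableEq K]

theorem Fits.maxDemand_le (hm : Fits q c m) (hq : IsDemand q) (W : Finset T) (A : Finset I) :
    maxDemand q W (classUnion c A) ≤ ∑ i ∈ A, (m i : ℤ) :=
  (hq.maxDemand_le_of_subset (subset_univ W) Subset.rfl).trans (hm A)

theorem Fits.add_maxDemand_compl_le (hm : Fits q c m) (hq : IsDemand q) (X : Finset T)
    (A : Finset I) :
    q X (classUnion c A) + maxDemand q Xᶜ (classUnion c A) ≤ ∑ i ∈ A, (m i : ℤ) :=
  (hq.add_maxDemand_compl_le X _).trans (hm A)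

theorem IsCritical.inter (hq : IsDemand q) (hm : Fits q c m)
    (h₀ : A₀ ∈ upperBounds (avoidingTight q c m t)) (hA : IsCritical q c m t A X)
    (hA' : IsCritical q c m t A' X') (hnot : ¬ A ∩ A' ⊆ A₀) :
    ∃ C, X ∪ X' ⊆ C ∧ IsCritical q c m t (A ∩ A') C := by
  have hunion := hm (A ∪ A')
  have hsum := sum_union_inter (s₁ := A) (s₂ := A') (f := fun i => (m i : ℤ))
  have hle := hA.le
  have hle' := hA'.le
  have hcases := hq.exists_superset_or_avoiding hA.mem hA'.mem hA.pos hA'.pos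
  rw [← classUnion_inter, ← classUnion_union] at hcases
  rcases hcases with ⟨C, hC, hCle⟩ | hmax
  · have htC : t ∈ C := hC (mem_union_left X' hA.mem)
    refine ⟨C, hC, htC, (hq.nonneg C _).lt_of_ne' fun hzero => hnot (h₀ (mem_avoidingTight.2 ?_)),
      by linarith⟩
    have hcompl := hq.maxDemand_le_of_subset (Y := classUnion c (A ∩ A'))
      (compl_subset_compl.2 (singleton_subset_iff.2 htC)) Subset.rfl
    linarith
  · refine absurd (h₀ (mem_avoidingTight.2 ?_)) hnot
    linarith

theorem IsCritical.apply_classUnion_le_zero (hq : IsDemand q) (hm : Fits q c m)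
    (h₀ : IsGreatest (avoidingTight q c m t) A₀) (hA : IsCritical q c m t A X)
    (hnot : ¬ A ⊆ A₀) : q X (classUnion c A₀) ≤ 0 := by
  have htight : ∑ i ∈ A₀, (m i : ℤ) ≤ maxDemand q {t}ᶜ (classUnion c A₀) := h₀.1
  have hcases := hq.maxDemand_compl_singleton_le_or hA.mem hA.pos (classUnion c A₀)
  rw [← classUnion_inter, ← classUnion_union] at hcases
  rcases hcases with hXc | hunion
  · linarith [hm.add_maxDemand_compl_le hq X A₀]
  · refine absurd (subset_union_left.trans (h₀.2 ((mem_avoidingTight (A := A ∪ A₀)).2 ?_))) hnot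
    linarith [hA.le, hm (A ∩ A₀), sum_union_inter (s₁ := A) (s₂ := A₀) (f := fun i => (m i : ℤ))]

theorem mem_of_isGreatest_avoidingTight (hq : IsDemand q)
    (h₀ : IsGreatest (avoidingTight q c m t) A₀) {i : I} (hi : m i = 0) : i ∈ A₀ := by
  by_contra hi₀
  refine hi₀ (h₀.2 ((mem_avoidingTight (A := insert i A₀)).2 ?_) (mem_insert_self i A₀))
  rw [sum_insert hi₀, hi, Nat.cast_zero, zero_add]
  exact le_trans h₀.1 (hq.maxDemand_le_of_subset Subset.rfl
    (classUnion_mono c (subset_insert i A₀)))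

theorem IsCritical.exists_erase_lt (hq : IsDemand q) (hm : Fits q c m)
    (h₀ : IsGreatest (avoidingTight q c m t) A₀) (hA : IsCritical q c m t A X)
    (hnot : ¬ A ⊆ A₀) :
    ∃ k, c k ∈ A ∧ c k ∉ A₀ ∧ 0 < m (c k) ∧
      q X ((classUnion c A).erase k) < q X (classUnion c A) := by
  by_contra! hno
  have hsdiff := hq.le_sdiff (Z := univ.filter fun k => c k ∈ A ∧ c k ∉ A₀ ∧ 0 < m (c k)) hA.pos
    fun k hk => by
      obtain ⟨-, hkA, hk₀, hmk⟩ := mem_filter.1 hk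
      exact hno k hkA hk₀ hmk
  have hsub : classUnion c A \ (univ.filter fun k => c k ∈ A ∧ c k ∉ A₀ ∧ 0 < m (c k)) ⊆
      classUnion c A₀ := by
    intro k hk
    simp only [mem_sdiff, mem_classUnion, mem_filter, mem_univ, true_and, not_and, not_lt,
      Nat.le_zero] at hk ⊢
    by_contra hk₀
    exact hk₀ (mem_of_isGreatest_avoidingTight hq h₀ (hk.2 hk.1 hk₀))
  linarith [hA.pos, hq.mono X hsub, hA.apply_classUnion_le_zero hq hm h₀ hnot]

theorem IsCritical.erase_lt (hq : IsDemand q) (hA : IsCritical q c m t A X)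
    (hA₁ : IsCritical q c m t A₁ X₁) (hAA₁ : A₁ ⊆ A) (hXX₁ : X ⊆ X₁)
    (hk : q X₁ ((classUnion c A₁).erase k) < q X₁ (classUnion c A₁)) :
    q X ((classUnion c A).erase k) < q X (classUnion c A) := by
  by_contra! hle
  have hsub := classUnion_mono c hAA₁
  have hadd := hq.add_le ⟨t, mem_inter.2 ⟨hA₁.mem, hA.mem⟩⟩ hA₁.pos (hA.pos.trans_le hle)
  rw [union_eq_left.2 hXX₁, inter_eq_right.2 hXX₁, inter_erase, inter_eq_left.2 hsub] at hadd
  linarith [hq.mono X (union_subset hsub (erase_subset k (classUnion c A)))]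

theorem Fits.residual (hq : IsDemand q) (hm : Fits q c m)
    (h₀ : A₀ ∈ upperBounds (avoidingTight q c m t)) (hmk : 0 < m (c k)) (hk : c k ∉ A₀)
    (hcrit : ∀ A X, c k ∈ A → IsCritical q c m t A X →
      q X ((classUnion c A).erase k) < q X (classUnion c A)) :
    Fits (residual q t k) c (m - Pi.single (c k) 1) := by
  intro A
  obtain ⟨F, hF, -, hsum⟩ := (hq.residual t k).exists_sum_eq_maxDemand univ (classUnion c A)
  have hle : ∀ X ∈ F, BipCover.residual q t k X (classUnion c A) ≤ q X (classUnion c A) :=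
    fun X _ => residual_le hq t k X _
  have hFm := (sum_le_maxDemand (q := q) (Y := classUnion c A) hF.disjoint (subset_univ _)).trans
    (hm A)
  rw [← hsum, sum_sub_single hmk]
  split_ifs with hkA
  swap
  · simpa using (sum_le_sum hle).trans hFm
  rw [Int.le_sub_one_iff]
  by_contra! hge
  have heq : ∀ X ∈ F, BipCover.residual q t k X (classUnion c A) = q X (classUnion c A) :=
    (sum_eq_sum_iff_of_le hle).1 ((sum_le_sum hle).antisymm (hFm.trans hge))
  rw [sum_congr rfl heq] at hge
  by_cases ht : t ∈ F.biUnion id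
  · obtain ⟨X, hXF, htX⟩ := mem_biUnion.1 ht
    have hpos : 0 < q X (classUnion c A) := heq X hXF ▸ hF.pos X hXF
    have hlt := hcrit A X hkA ⟨htX, hpos, hge.trans (sum_le_add_maxDemand_compl hF.disjoint hXF)⟩
    have hmax := heq X hXF
    rw [BipCover.residual, if_pos ⟨htX, mem_classUnion.2 hkA⟩] at hmax
    exact (max_lt (sub_one_lt _) hlt).ne hmax
  · exact hk (h₀ (hge.trans (sum_le_maxDemand hF.disjoint (subset_compl_singleton.2 ht))) hkA)

variable [Fintype I]

theorem exists_minimal_isCritical (hq : IsDemand q) (hm : Fits q c m)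
    (h₀ : IsGreatest (avoidingTight q c m t) A₀) (ht : 0 < q {t} univ)
    (hfull : ∑ i, (m i : ℤ) ≤ ∑ t, q {t} univ) :
    ∃ A₁ X₁, IsCritical q c m t A₁ X₁ ∧ ¬ A₁ ⊆ A₀ ∧
      ∀ A X, IsCritical q c m t A X → ¬ A₁ ∩ A ⊆ A₀ → A₁ ⊆ A ∧ X ⊆ X₁ := by
  have huniv : ¬ univ ⊆ A₀ := by
    rw [univ_subset_iff]
    rintro rfl
    have hle : ∑ i, (m i : ℤ) ≤ maxDemand q {t}ᶜ (classUnion c univ) := h₀.1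
    have := hm.add_maxDemand_compl_le hq {t} univ
    rw [classUnion_univ] at hle this
    linarith
  obtain ⟨⟨A₁, X₁⟩, ⟨hA₁, hnot⟩, hmin⟩ := exists_minimal_of_wellFoundedLT
    (fun z : Finset I × (Finset T)ᵒᵈ => IsCritical q c m t z.1 (OrderDual.ofDual z.2) ∧ ¬ z.1 ⊆ A₀)
    ⟨(univ, OrderDual.toDual {t}), isCritical_univ_singleton ht hfull, huniv⟩
  refine ⟨A₁, OrderDual.ofDual X₁, hA₁, hnot, fun A X hA hne => ?_⟩
  obtain ⟨C, hC, hcrit⟩ := hA₁.inter hq hm h₀.2 hA hne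
  obtain ⟨hle₁, hle₂⟩ := hmin (y := (A₁ ∩ A, OrderDual.toDual C)) ⟨hcrit, hne⟩
    ⟨inter_subset_left, subset_union_left.trans hC⟩
  exact ⟨hle₁.trans inter_subset_right, subset_union_right.trans (hC.trans hle₂)⟩

theorem Fits.exists_residual (hq : IsDemand q) (hm : Fits q c m) (ht : 0 < q {t} univ)
    (hfull : ∑ i, (m i : ℤ) ≤ ∑ t, q {t} univ) :
    ∃ k, 0 < m (c k) ∧ Fits (BipCover.residual q t k) c (m - Pi.single (c k) 1) := by
  obtain ⟨A₀, h₀⟩ : ∃ A₀, IsGreatest (avoidingTight q c m t) A₀ :=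
    (hq.supermodular_maxDemand {t}ᶜ c).exists_isGreatest_tight maxDemand_nonneg
      (hm.maxDemand_le hq {t}ᶜ)
  obtain ⟨A₁, X₁, hA₁, hnot, hmin⟩ := exists_minimal_isCritical hq hm h₀ ht hfull
  obtain ⟨k, hkA₁, hk₀, hmk, hlt⟩ := hA₁.exists_erase_lt hq hm h₀ hnot
  refine ⟨k, hmk, hm.residual hq h₀.2 hmk hk₀ fun A X hkA hA => ?_⟩
  obtain ⟨hAA₁, hXX₁⟩ := hmin A X hA fun hsub => hk₀ (hsub (mem_inter.2 ⟨hkA₁, hkA⟩))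
  exact hA.erase_lt hq hA₁ hAA₁ hXX₁ hlt

end EdgeSelection

section Covering

variable {T K I : Type*}

/-- The bipartite multigraph with `x t k` edges between `t` and `k` meets the demand `q`. -/
def IsCovering (q : Finset T → Finset K → ℤ) (x : T → K → ℕ) : Prop :=
  ∀ X Y, q X Y ≤ ∑ t ∈ X, ∑ k ∈ Y, (x t k : ℤ)

variable [DecidableEq T] [DecidableEq K]

theorem sum_sum_add_ite (x : T → K → ℕ) (t : T) (k : K) (X : Finset T) (Y : Finset K) :
    ∑ u ∈ X, ∑ j ∈ Y, ((x u j + if u = t ∧ j = k then 1 else 0 : ℕ) : ℤ) =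
      ∑ u ∈ X, ∑ j ∈ Y, (x u j : ℤ) + if t ∈ X ∧ k ∈ Y then 1 else 0 := by
  push_cast
  simp_rw [sum_add_distrib, ite_and, sum_ite_irrel, sum_const_zero, sum_ite_eq']

variable [Fintype T] [Fintype K] [Fintype I] [DecidableEq I] {q : Finset T → Finset K → ℤ}
  {c : K → I} {m : I → ℕ}

theorem Fits.apply_le_sum (hm : Fits q c m) (hq : IsDemand q) (X : Finset T) (Y : Finset K) :
    q X Y ≤ ∑ i, (m i : ℤ) :=
  calc q X Y ≤ q X (classUnion c univ) := hq.mono X (by simp [classUnion_univ])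
    _ ≤ q X (classUnion c univ) + maxDemand q Xᶜ (classUnion c univ) :=
      le_add_of_nonneg_right maxDemand_nonneg
    _ ≤ ∑ i, (m i : ℤ) := hm.add_maxDemand_compl_le hq X univ

theorem sum_sub_one_le_sum_residual (hq : IsDemand q) (t : T) (k : K) :
    ∑ u, q {u} univ - 1 ≤ ∑ u, residual q t k {u} univ := by
  have hle := sum_le_sum fun u (_ : u ∈ univ) =>
    sub_ite_le_residual hq t k {u} (Subset.refl (univ : Finset K))
  simpa [sum_sub_distrib] using hle

theorem IsDemand.exists_covering (hq : IsDemand q) (hm : Fits q c m)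
    (hfull : ∑ i, (m i : ℤ) ≤ ∑ t, q {t} univ) :
    ∃ x : T → K → ℕ, IsCovering q x ∧
      ∀ A, ∑ t, ∑ k ∈ classUnion c A, (x t k : ℤ) ≤ ∑ i ∈ A, (m i : ℤ) := by
  obtain ⟨n, hn⟩ : ∃ n : ℕ, ∑ i, (m i : ℤ) = n := ⟨∑ i, m i, by push_cast; rfl⟩
  induction n generalizing q m with
  | zero =>
    refine ⟨fun _ _ => 0, fun X Y => ?_, fun A => ?_⟩
    · simpa [hn] using hm.apply_le_sum hq X Y
    · simpa using sum_nonneg fun i (_ : i ∈ A) => Int.natCast_nonneg (m i)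
  | succ n ih =>
    push_cast at hn
    obtain ⟨t, -, ht⟩ : ∃ t ∈ univ, 0 < q {t} univ := by
      by_contra! hno
      linarith [sum_nonpos hno]
    obtain ⟨k, hmk, hfit⟩ := hm.exists_residual hq ht hfull
    have hsum := sum_sub_single hmk univ
    rw [if_pos (mem_univ _), hn, add_sub_cancel_right] at hsum
    obtain ⟨x, hx, hxm⟩ := ih (hq.residual t k) hfit
      (by linarith [sum_sub_one_le_sum_residual hq t k]) hsum
    refine ⟨fun u j => x u j + if u = t ∧ j = k then 1 else 0, fun X Y => ?_, fun A => ?_⟩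
    · rw [sum_sum_add_ite]
      linarith [hx X Y, sub_ite_le_residual hq t k X (Subset.refl Y)]
    · have hA := hxm A
      rw [sum_sub_single hmk] at hA
      rw [sum_sum_add_ite]
      simp only [mem_univ, true_and, mem_classUnion]
      linarith

end Covering

/-! ### Necessity -/

section RankFunctions

variable {S : Type*}

/-- The rank axioms of a matroid on `S`, the size of a set being an upper bound for its rank. -/
structure IsRankFunction [DecidableEq S] (ρ : Finset S → ℕ) : Prop where
  mono : Monotone ρ
  submodular : ∀ A B, ρ (A ∪ B) + ρ (A ∩ B) ≤ ρ A + ρ B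
  le_card : ∀ A, ρ A ≤ #A

theorem coe_rank (M : Matroid S) (A : Finset S) : (rank M A : ℕ∞) = M.eRk A :=
  ENat.natCast_toNat (ne_top_of_le_ne_top (by simp) (M.eRk_le_encard _))

variable [DecidableEq S]

theorem isRankFunction_card : IsRankFunction (card : Finset S → ℕ) :=
  ⟨card_mono, fun A B => (card_union_add_card_inter A B).le, fun _ => le_rfl⟩

theorem isRankFunction_rank (M : Matroid S) : IsRankFunction (rank M) := by
  refine ⟨fun A B h => ?_, fun A B => ?_, fun A => ?_⟩ <;> rw [← Nat.cast_le (α := ℕ∞)]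
  · rw [coe_rank, coe_rank]
    exact M.eRk_mono (coe_subset.2 h)
  · rw [Nat.cast_add, Nat.cast_add, add_comm]
    simp only [coe_rank, coe_union, coe_inter]
    exact M.eRk_inter_add_eRk_union_le _ _
  · rw [coe_rank, ← Set.encard_coe_eq_coe_finsetCard]
    exact M.eRk_le_encard _

theorem IsRankFunction.union_le {ρ : Finset S → ℕ} (hρ : IsRankFunction ρ) (A B : Finset S) :
    ρ (A ∪ B) ≤ ρ A + #(B \ A) := by
  have hsub := hρ.submodular A (B \ A)
  have hcard := hρ.le_card (B \ A)
  rw [union_sdiff_self_eq_union] at hsub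
  omega

end RankFunctions

section Counting

variable {S T : Type*} [DecidableEq S] [DecidableEq T]

/-- The number of edges of `E` between `X ⊆ T` and `Z ⊆ S`. -/
def edgesBetween (E : Finset (S × T)) (X : Finset T) (Z : Finset S) : ℕ :=
  #(E ∩ Z ×ˢ X)

theorem edgesBetween_eq_sum (E : Finset (S × T)) (X : Finset T) (Z : Finset S) :
    edgesBetween E X Z = ∑ t ∈ X, ∑ s ∈ Z, if (s, t) ∈ E then 1 else 0 := by
  rw [edgesBetween, inter_comm, ← filter_mem_eq_inter, card_filter, sum_product_right]

theorem edgesBetween_mono (E : Finset (S × T)) {X X' : Finset T} {Z Z' : Finset S} (hX : X ⊆ X')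
    (hZ : Z ⊆ Z') : edgesBetween E X Z ≤ edgesBetween E X' Z' :=
  card_le_card (inter_subset_inter_left (product_subset_product hZ hX))

theorem sum_degS [Fintype T] (E : Finset (S × T)) (Z : Finset S) :
    ∑ s ∈ Z, degS E s = edgesBetween E univ Z :=
  (sum_card_fiberwise_eq_card_filter E Z Prod.fst).trans (congr_arg card (by ext; simp))

theorem edgesBetween_biUnion (E : Finset (S × T)) {n : ℕ} {X : Fin n → Finset T}
    (hX : IsDisjointFamily X) (Z : Finset S) :
    edgesBetween E (univ.biUnion X) Z = ∑ j, edgesBetween E (X j) Z := by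
  simp_rw [edgesBetween_eq_sum]
  exact sum_biUnion fun i _ j _ => hX.2 i j

variable [Fintype S]

theorem sum_degT (E : Finset (S × T)) (X : Finset T) :
    ∑ t ∈ X, degT E t = edgesBetween E X univ :=
  (sum_card_fiberwise_eq_card_filter E X Prod.snd).trans (congr_arg card (by ext; simp))

theorem edgesBetween_add_edgesBetween_compl (E : Finset (S × T)) (X : Finset T) (Z : Finset S) :
    edgesBetween E X Z + edgesBetween E X Zᶜ = ∑ t ∈ X, degT E t := by
  simp_rw [sum_degT, edgesBetween_eq_sum, ← sum_add_distrib, sum_add_sum_compl]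

theorem mem_nbr {E : Finset (S × T)} {X : Finset T} {s : S} :
    s ∈ nbr E X ↔ ∃ t ∈ X, (s, t) ∈ E := by
  simp [nbr]

theorem mem_nbr_singleton {E : Finset (S × T)} {t : T} {s : S} :
    s ∈ nbr E {t} ↔ (s, t) ∈ E := by
  simp [mem_nbr]

theorem nbr_union_left (E E' : Finset (S × T)) (X : Finset T) :
    nbr (E ∪ E') X = nbr E X ∪ nbr E' X := by
  ext s
  simp only [mem_nbr, mem_union]
  grind

theorem card_nbr_inter_le (E : Finset (S × T)) (X : Finset T) (Z : Finset S) :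
    #(nbr E X ∩ Z) ≤ edgesBetween E X Z := by
  have hsub : nbr E X ∩ Z ⊆ (E ∩ Z ×ˢ X).image Prod.fst := by
    intro s hs
    obtain ⟨hsE, hsZ⟩ := mem_inter.1 hs
    obtain ⟨t, ht, hst⟩ := mem_nbr.1 hsE
    exact mem_image.2 ⟨(s, t), mem_inter.2 ⟨hst, mem_product.2 ⟨hsZ, ht⟩⟩, rfl⟩
  exact (card_le_card hsub).trans card_image_le

end Counting

section Partitions

variable {S : Type*} [Fintype S] [DecidableEq S] {l : ℕ} {P : Fin l → Finset S}

theorem IsPartition.exists_eq_fibers (hP : IsPartition P) :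
    ∃ cl : S → Fin l, ∀ s α, s ∈ P α ↔ cl s = α := by
  have hex : ∀ s, ∃ α, s ∈ P α := fun s => by
    simpa using (hP.2.2.symm ▸ mem_univ s : s ∈ univ.biUnion P)
  choose cl hcl using hex
  refine ⟨cl, fun s α => ⟨fun hs => ?_, fun h => h ▸ hcl s⟩⟩
  by_contra hne
  exact disjoint_left.1 (hP.2.1 _ _ hne) (hcl s) hs

theorem IsPartition.subset_biUnion_iff (hP : IsPartition P) {A : Finset (Fin l)} {α : Fin l} :
    P α ⊆ A.biUnion P ↔ α ∈ A := by
  refine ⟨fun h => ?_, fun h => subset_biUnion_of_mem P h⟩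
  obtain ⟨s, hs⟩ := hP.1 α
  obtain ⟨β, hβ, hsβ⟩ := mem_biUnion.1 (h hs)
  by_contra hα
  exact disjoint_left.1 (hP.2.1 α β fun h => hα (h ▸ hβ)) hs hsβ

theorem IsPartition.compl_biUnion (hP : IsPartition P) (A : Finset (Fin l)) :
    (A.biUnion P)ᶜ = Aᶜ.biUnion P := by
  obtain ⟨cl, hcl⟩ := hP.exists_eq_fibers
  ext s
  simp [hcl]

theorem IsPartition.subset_compl_biUnion_iff (hP : IsPartition P) {A : Finset (Fin l)}
    {α : Fin l} : P α ⊆ (A.biUnion P)ᶜ ↔ α ∈ Aᶜ := by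
  rw [hP.compl_biUnion, hP.subset_biUnion_iff]

end Partitions

section Necessity

variable {S T : Type*} [Fintype S] [DecidableEq S] [DecidableEq T] {l : ℕ}
  {P : Fin l → Finset S} {ρ : Finset S → ℕ} {E₀ E : Finset (S × T)} {p : Finset T → ℤ}
  {f₁ f₂ : Fin l → ℕ} {g : T → ℕ}

theorem IsPartition.upperIneq_iff (hP : IsPartition P) {n : ℕ} {X : Fin n → Finset T}
    {A : Finset (Fin l)} : UpperIneq ρ E₀ p P f₂ X (A.biUnion P) ↔
      ∑ j, (p (X j) - (ρ ((A.biUnion P)ᶜ ∪ nbr E₀ (X j)) : ℤ)) ≤ ∑ α ∈ A, (f₂ α : ℤ) := by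
  simp only [UpperIneq, hP.subset_biUnion_iff, filter_mem_eq_inter, univ_inter]

theorem Covers.le_add_edgesBetween (hρ : IsRankFunction ρ) (h : Covers ρ (E ∪ E₀) p)
    {X : Finset T} (hX : X.Nonempty) (Z : Finset S) :
    p X ≤ ρ (Zᶜ ∪ nbr E₀ X) + edgesBetween E X Z := by
  have hnbr : nbr E X \ (Zᶜ ∪ nbr E₀ X) ⊆ nbr E X ∩ Z := by grind [mem_compl]
  have hrank : ρ (nbr (E ∪ E₀) X) ≤ ρ (Zᶜ ∪ nbr E₀ X) + edgesBetween E X Z :=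
    calc ρ (nbr (E ∪ E₀) X) ≤ ρ (Zᶜ ∪ nbr E₀ X ∪ nbr E X) :=
          hρ.mono (by rw [nbr_union_left]; grind)
      _ ≤ ρ (Zᶜ ∪ nbr E₀ X) + #(nbr E X \ (Zᶜ ∪ nbr E₀ X)) := hρ.union_le _ _
      _ ≤ ρ (Zᶜ ∪ nbr E₀ X) + edgesBetween E X Z := by
          gcongr
          exact (card_le_card hnbr).trans (card_nbr_inter_le E X Z)
  exact (h X hX).trans (by exact_mod_cast hrank)

theorem edgesBetween_le_sum_gRestrict (hE : Disjoint E E₀) (hg : ∀ t, degT E t ≤ g t)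
    (X : Finset T) (Z : Finset S) : edgesBetween E X Z ≤ ∑ t ∈ X, gRestrict E₀ g Z t := by
  rw [edgesBetween_eq_sum]
  refine sum_le_sum fun t _ => le_min ?_ (le_trans ?_ (hg t))
  · rw [← card_filter]
    refine card_le_card fun s hs => ?_
    obtain ⟨hsZ, hsE⟩ := mem_filter.1 hs
    exact mem_sdiff.2 ⟨hsZ, fun h => disjoint_left.1 hE hsE (mem_nbr_singleton.1 h)⟩
  · rw [← sum_singleton (degT E) t, sum_degT, edgesBetween_eq_sum, sum_singleton]
    exact sum_le_sum_of_subset (subset_univ _)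

theorem IsGoodAugmentation.add_edgesBetween_compl_le (hρ : IsRankFunction ρ)
    (hE : IsGoodAugmentation ρ E₀ p P f₁ f₂ g E) {X : Finset T} (hX : X.Nonempty)
    (Z : Finset S) :
    p X + edgesBetween E X Zᶜ ≤ ρ (Zᶜ ∪ nbr E₀ X) + ∑ t ∈ X, (g t : ℤ) := by
  have hcov := hE.1.2.le_add_edgesBetween hρ hX Z
  have hdeg : edgesBetween E X Z + edgesBetween E X Zᶜ ≤ ∑ t ∈ X, g t := by
    rw [edgesBetween_add_edgesBetween_compl]
    exact sum_le_sum fun t _ => hE.2.2 t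
  zify at hdeg
  linarith

theorem IsGoodAugmentation.upperIneq [Finite T] (hρ : IsRankFunction ρ) (hP : IsPartition P)
    (hE : IsGoodAugmentation ρ E₀ p P f₁ f₂ g E) {n : ℕ} {X : Fin n → Finset T} {S₀ : Finset S}
    (hX : IsDisjointFamily X) (hS₀ : IsUnionOfParts P S₀) : UpperIneq ρ E₀ p P f₂ X S₀ := by
  cases nonempty_fintype T
  obtain ⟨A, rfl⟩ := hS₀
  rw [hP.upperIneq_iff]
  have hedges : ∑ j, edgesBetween E (X j) (A.biUnion P) ≤ ∑ α ∈ A, f₂ α :=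
    calc ∑ j, edgesBetween E (X j) (A.biUnion P)
        = edgesBetween E (univ.biUnion X) (A.biUnion P) := (edgesBetween_biUnion E hX _).symm
      _ ≤ edgesBetween E univ (A.biUnion P) := edgesBetween_mono E (subset_univ _) Subset.rfl
      _ = ∑ α ∈ A, ∑ s ∈ P α, degS E s := by
          rw [← sum_degS, sum_biUnion fun α _ β _ => hP.2.1 α β]
      _ ≤ ∑ α ∈ A, f₂ α := sum_le_sum fun α _ => (hE.2.1 α).2
  zify at hedges
  refine le_trans (sum_le_sum fun j _ => ?_) hedges
  linarith [hE.1.2.le_add_edgesBetween hρ (hX.1 j) (A.biUnion P)]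

variable [Fintype T]

theorem IsPartition.lowerIneq_iff (hP : IsPartition P) {n : ℕ} {X : Fin n → Finset T}
    {A : Finset (Fin l)} : LowerIneq ρ E₀ p P f₁ g X (A.biUnion P) ↔
      ∑ j, p (X j) + ∑ α ∈ Aᶜ, (f₁ α : ℤ)
          - ∑ t ∈ (univ.biUnion X)ᶜ, (gRestrict E₀ g (A.biUnion P)ᶜ t : ℤ)
        ≤ ∑ j, ((ρ ((A.biUnion P)ᶜ ∪ nbr E₀ (X j)) : ℤ) + ∑ t ∈ X j, (g t : ℤ)) := by
  simp only [LowerIneq, hP.subset_compl_biUnion_iff, filter_mem_eq_inter, univ_inter,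
    compl_eq_univ_sdiff (univ.biUnion X)]

theorem IsGoodAugmentation.lowerIneq (hρ : IsRankFunction ρ) (hP : IsPartition P)
    (hE : IsGoodAugmentation ρ E₀ p P f₁ f₂ g E) {n : ℕ} {X : Fin n → Finset T} {S₀ : Finset S}
    (hX : IsDisjointFamily X) (hS₀ : IsUnionOfParts P S₀) : LowerIneq ρ E₀ p P f₁ g X S₀ := by
  obtain ⟨A, rfl⟩ := hS₀
  rw [hP.lowerIneq_iff]
  set Z := (A.biUnion P)ᶜ with hZ
  have hlower : ∑ α ∈ Aᶜ, f₁ α ≤ edgesBetween E univ Z := by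
    rw [← sum_degS, hZ, hP.compl_biUnion, sum_biUnion fun α _ β _ => hP.2.1 α β]
    exact sum_le_sum fun α _ => (hE.2.1 α).1
  have hsplit : edgesBetween E univ Z =
      ∑ j, edgesBetween E (X j) Z + edgesBetween E (univ.biUnion X)ᶜ Z := by
    rw [← edgesBetween_biUnion E hX]
    simp_rw [edgesBetween_eq_sum, sum_add_sum_compl]
  have houtside := edgesBetween_le_sum_gRestrict hE.1.1 hE.2.2 (univ.biUnion X)ᶜ Z
  have hinside := sum_le_sum fun j (_ : j ∈ univ) =>
    hE.add_edgesBetween_compl_le hρ (hX.1 j) (A.biUnion P)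
  rw [sum_add_distrib] at hinside
  zify at hlower hsplit houtside
  linarith

end Necessity

/-! ### The demand of an augmentation problem -/

section AugmentationDemand

variable {S T : Type*} [Fintype S] [DecidableEq S] {Y Y' : Finset (Option S)}

/-- The vertices of `S` outside `Y ⊆ S ∪ {none}`. The extra vertex `none` is a sink for the degree
that the vertices of `T` do not use up. -/
def outside (Y : Finset (Option S)) : Finset S :=
  (eraseNone Y)ᶜ

theorem mem_outside {s : S} : s ∈ outside Y ↔ some s ∉ Y := by
  simp [outside]

theorem outside_union (Y Y' : Finset (Option S)) :
    outside (Y ∪ Y') = outside Y ∩ outside Y' := by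
  rw [outside, eraseNone_union, compl_union, outside, outside]

theorem outside_inter (Y Y' : Finset (Option S)) :
    outside (Y ∩ Y') = outside Y ∪ outside Y' := by
  rw [outside, eraseNone_inter, compl_inter, outside, outside]

theorem outside_anti : Antitone (outside (S := S)) :=
  fun _ _ h => compl_subset_compl.2 (eraseNone.monotone h)

variable [DecidableEq T]

theorem nbr_union_right (E : Finset (S × T)) (X X' : Finset T) :
    nbr E (X ∪ X') = nbr E X ∪ nbr E X' := by
  ext s
  simp only [mem_nbr, mem_union]
  grind

theorem nbr_mono (E : Finset (S × T)) : Monotone (nbr E) := by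
  intro X X' h s hs
  obtain ⟨t, ht, hst⟩ := mem_nbr.1 hs
  exact mem_nbr.2 ⟨t, h ht, hst⟩

theorem PosIntersectingSupermodular.add_le {p : Finset T → ℤ}
    (hp : PosIntersectingSupermodular p) {X X' : Finset T} (hX : (X ∩ X').Nonempty)
    (hpos : 0 < p X) (hpos' : 0 < p X') : p X + p X' ≤ p (X ∪ X') + p (X ∩ X') := by
  rcases (X \ X').eq_empty_or_nonempty with h | h
  · rw [sdiff_eq_empty_iff_subset] at h
    rw [union_eq_right.2 h, inter_eq_left.2 h, add_comm]
  rcases (X' \ X).eq_empty_or_nonempty with h' | h'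
  · rw [sdiff_eq_empty_iff_subset] at h'
    rw [union_eq_left.2 h', inter_eq_right.2 h']
  · exact hp X X' ⟨hX, h, h'⟩ hpos hpos'

/-- The number of edges between `X` and `Y` that covering `p X` requires: the edges leaving `X`
outside of `Y` contribute at most `outside Y` to its neighbourhood. -/
def coverDemand (ρ : Finset S → ℕ) (E₀ : Finset (S × T)) (p : Finset T → ℤ) (X : Finset T)
    (Y : Finset (Option S)) : ℤ :=
  p X - ρ (outside Y ∪ nbr E₀ X)

/-- The number of edges between `t` and `Y ∋ none` that is required if `t` has degree `g t` and
there is at most one edge, not parallel to an edge of `E₀`, between `t` and any `s ∈ S`. -/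
def degreeDemand (E₀ : Finset (S × T)) (g : T → ℕ) (t : T) (Y : Finset (Option S)) : ℤ :=
  g t - #(outside Y \ nbr E₀ {t})

variable {ρ : Finset S → ℕ} {E₀ : Finset (S × T)} {p : Finset T → ℤ} {g : T → ℕ} {X X' : Finset T}
  {t : T}

theorem coverDemand_mono (hρ : IsRankFunction ρ) (X : Finset T) :
    Monotone (coverDemand ρ E₀ p X) := fun _ _ h =>
  sub_le_sub_left (Nat.cast_le.2 (hρ.mono (union_subset_union_left (outside_anti h)))) _

theorem degreeDemand_mono (t : T) : Monotone (degreeDemand E₀ g t) := fun _ _ h =>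
  sub_le_sub_left (Nat.cast_le.2 (card_le_card (sdiff_subset_sdiff (outside_anti h) Subset.rfl))) _

theorem degreeDemand_univ (t : T) : degreeDemand E₀ g t univ = g t := by
  have houtside : outside (univ : Finset (Option S)) = ∅ := by
    ext s
    simp [mem_outside]
  simp [degreeDemand, houtside]

theorem coverDemand_add_le (hρ : IsRankFunction ρ) (hp : PosIntersectingSupermodular p)
    (hX : (X ∩ X').Nonempty) (hpos : 0 < coverDemand ρ E₀ p X Y)
    (hpos' : 0 < coverDemand ρ E₀ p X' Y') :
    coverDemand ρ E₀ p X Y + coverDemand ρ E₀ p X' Y' ≤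
      coverDemand ρ E₀ p (X ∪ X') (Y ∩ Y') + coverDemand ρ E₀ p (X ∩ X') (Y ∪ Y') := by
  unfold coverDemand at *
  have hsuper := hp.add_le hX (by lia) (by lia)
  have hsub := hρ.submodular (outside Y ∪ nbr E₀ X) (outside Y' ∪ nbr E₀ X')
  have hunion : outside (Y ∩ Y') ∪ nbr E₀ (X ∪ X') =
      outside Y ∪ nbr E₀ X ∪ (outside Y' ∪ nbr E₀ X') := by
    rw [outside_inter, nbr_union_right, union_union_union_comm]
  have hinter : outside (Y ∪ Y') ∪ nbr E₀ (X ∩ X') ⊆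
      (outside Y ∪ nbr E₀ X) ∩ (outside Y' ∪ nbr E₀ X') := by
    rw [outside_union]
    exact subset_inter
      (union_subset_union inter_subset_left (nbr_mono E₀ inter_subset_left))
      (union_subset_union inter_subset_right (nbr_mono E₀ inter_subset_right))
  have hmono := hρ.mono hinter
  rw [hunion]
  lia

theorem degreeDemand_add_coverDemand_le (hρ : IsRankFunction ρ) (ht : t ∈ X) :
    degreeDemand E₀ g t Y + coverDemand ρ E₀ p X Y' ≤
      coverDemand ρ E₀ p X (Y ∩ Y') + degreeDemand E₀ g t (Y ∪ Y') := by
  unfold coverDemand degreeDemand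
  have hrank := hρ.union_le (outside Y' ∪ nbr E₀ X) (outside (Y ∩ Y') ∪ nbr E₀ X)
  have hunion : outside Y' ∪ nbr E₀ X ∪ (outside (Y ∩ Y') ∪ nbr E₀ X) =
      outside (Y ∩ Y') ∪ nbr E₀ X := by
    rw [outside_inter]
    grind
  have hnbr : nbr E₀ {t} ⊆ nbr E₀ X := nbr_mono E₀ (singleton_subset_iff.2 ht)
  have hcard : #((outside (Y ∩ Y') ∪ nbr E₀ X) \ (outside Y' ∪ nbr E₀ X)) +
      #(outside (Y ∪ Y') \ nbr E₀ {t}) ≤ #(outside Y \ nbr E₀ {t}) := by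
    rw [outside_inter, outside_union, ← card_union_of_disjoint]
    · exact card_le_card (by grind)
    · rw [disjoint_left]
      grind
  rw [hunion] at hrank
  lia

theorem degreeDemand_add_degreeDemand (t : T) (Y Y' : Finset (Option S)) :
    degreeDemand E₀ g t Y + degreeDemand E₀ g t Y' =
      degreeDemand E₀ g t (Y ∩ Y') + degreeDemand E₀ g t (Y ∪ Y') := by
  unfold degreeDemand
  have hcard := card_union_add_card_inter (outside Y \ nbr E₀ {t}) (outside Y' \ nbr E₀ {t})
  have hinter : outside Y \ nbr E₀ {t} ∩ (outside Y' \ nbr E₀ {t}) =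
      outside (Y ∪ Y') \ nbr E₀ {t} := by
    rw [outside_union]
    exact inf_sdiff.symm
  rw [← union_sdiff_distrib, ← outside_inter, hinter] at hcard
  lia

/-- The demand expressing that `p` is covered and that every `t` has degree at least `g t`, with no
edge parallel to another one or to an edge of `E₀` once that degree is exactly `g t`. The inner sum
has a single summand. -/
def demand (ρ : Finset S → ℕ) (E₀ : Finset (S × T)) (p : Finset T → ℤ) (g : T → ℕ) (X : Finset T)
    (Y : Finset (Option S)) : ℤ :=
  if X = ∅ then 0
  else if none ∈ Y ∧ #X = 1 then
    max 0 (max (coverDemand ρ E₀ p X Y) (∑ t ∈ X, degreeDemand E₀ g t Y))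
  else max 0 (coverDemand ρ E₀ p X Y)

theorem demand_empty (Y : Finset (Option S)) : demand ρ E₀ p g ∅ Y = 0 :=
  if_pos rfl

theorem nonempty_of_demand_pos (hpos : 0 < demand ρ E₀ p g X Y) : X.Nonempty := by
  rw [nonempty_iff_ne_empty]
  rintro rfl
  exact hpos.ne' (demand_empty Y)

theorem demand_nonneg (X : Finset T) (Y : Finset (Option S)) : 0 ≤ demand ρ E₀ p g X Y := by
  unfold demand
  split_ifs <;> simp

theorem coverDemand_le_demand (hX : X.Nonempty) (Y : Finset (Option S)) :
    coverDemand ρ E₀ p X Y ≤ demand ρ E₀ p g X Y := by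
  rw [demand, if_neg hX.ne_empty]
  split_ifs <;> simp

theorem degreeDemand_le_demand (t : T) (hY : none ∈ Y) :
    degreeDemand E₀ g t Y ≤ demand ρ E₀ p g {t} Y := by
  rw [demand, if_neg (singleton_ne_empty t), if_pos ⟨hY, card_singleton t⟩, sum_singleton]
  simp

theorem demand_cases (hpos : 0 < demand ρ E₀ p g X Y) :
    demand ρ E₀ p g X Y = coverDemand ρ E₀ p X Y ∨
      ∃ t, X = {t} ∧ none ∈ Y ∧ demand ρ E₀ p g X Y = degreeDemand E₀ g t Y := by
  have hX := (nonempty_of_demand_pos hpos).ne_empty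
  have hmax {a : ℤ} (ha : 0 < max 0 a) : max 0 a = a :=
    max_eq_right ((lt_max_iff.1 ha).resolve_left (lt_irrefl 0)).le
  rw [demand, if_neg hX] at hpos ⊢
  split_ifs at hpos ⊢ with h
  · obtain ⟨t, rfl⟩ := card_eq_one.1 h.2
    rw [sum_singleton] at hpos ⊢
    rw [hmax hpos]
    exact (max_choice _ _).imp_right fun h' => ⟨t, rfl, h.1, h'⟩
  · exact Or.inl (hmax hpos)

theorem demand_mono (hρ : IsRankFunction ρ) (X : Finset T) : Monotone (demand ρ E₀ p g X) := by
  intro Y Y' h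
  rcases (demand_nonneg X Y).eq_or_lt with hzero | hpos
  · exact hzero ▸ demand_nonneg X Y'
  rcases demand_cases hpos with heq | ⟨t, rfl, hY, heq⟩ <;> rw [heq]
  · exact (coverDemand_mono hρ X h).trans
      (coverDemand_le_demand (nonempty_of_demand_pos hpos) Y')
  · exact (degreeDemand_mono t h).trans (degreeDemand_le_demand t (h hY))

theorem degreeDemand_add_demand_le (hρ : IsRankFunction ρ) (ht : t ∈ X) (hY : none ∈ Y)
    (hpos : 0 < demand ρ E₀ p g X Y') :
    degreeDemand E₀ g t Y + demand ρ E₀ p g X Y' ≤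
      demand ρ E₀ p g X (Y ∩ Y') + demand ρ E₀ p g {t} (Y ∪ Y') := by
  have hunion := degreeDemand_le_demand (ρ := ρ) (E₀ := E₀) (p := p) (g := g) t
    (mem_union_left Y' hY)
  rcases demand_cases hpos with heq | ⟨t', rfl, hY', heq⟩ <;> rw [heq]
  · exact (degreeDemand_add_coverDemand_le hρ ht).trans
      (add_le_add (coverDemand_le_demand ⟨t, ht⟩ _) hunion)
  · obtain rfl := mem_singleton.1 ht
    exact (degreeDemand_add_degreeDemand t Y Y').trans_le
      (add_le_add (degreeDemand_le_demand t (mem_inter.2 ⟨hY, hY'⟩)) hunion)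

theorem demand_add_le (hρ : IsRankFunction ρ) (hp : PosIntersectingSupermodular p)
    (hX : (X ∩ X').Nonempty) (hpos : 0 < demand ρ E₀ p g X Y)
    (hpos' : 0 < demand ρ E₀ p g X' Y') :
    demand ρ E₀ p g X Y + demand ρ E₀ p g X' Y' ≤
      demand ρ E₀ p g (X ∪ X') (Y ∩ Y') + demand ρ E₀ p g (X ∩ X') (Y ∪ Y') := by
  rcases demand_cases hpos with heq | ⟨t, rfl, hY, heq⟩
  · rcases demand_cases hpos' with heq' | ⟨t', rfl, hY', heq'⟩
    · rw [heq] at hpos ⊢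
      rw [heq'] at hpos' ⊢
      exact (coverDemand_add_le hρ hp hX hpos hpos').trans (add_le_add
        (coverDemand_le_demand (hX.mono (inter_subset_left.trans subset_union_left)) _)
        (coverDemand_le_demand hX _))
    · have ht' : t' ∈ X := by simpa [← not_disjoint_iff_nonempty_inter] using hX
      rw [heq', union_eq_left.2 (singleton_subset_iff.2 ht'),
        inter_eq_right.2 (singleton_subset_iff.2 ht'), add_comm, inter_comm, union_comm]
      exact degreeDemand_add_demand_le hρ ht' hY' hpos
  · have ht : t ∈ X' := by simpa [← not_disjoint_iff_nonempty_inter] using hX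
    rw [heq, union_eq_right.2 (singleton_subset_iff.2 ht),
      inter_eq_left.2 (singleton_subset_iff.2 ht)]
    exact degreeDemand_add_demand_le hρ ht hY hpos'

theorem isDemand_demand (hρ : IsRankFunction ρ) (hp : PosIntersectingSupermodular p)
    (E₀ : Finset (S × T)) (g : T → ℕ) : IsDemand (demand ρ E₀ p g) :=
  ⟨demand_nonneg, demand_empty, demand_mono hρ, demand_add_le hρ hp⟩

end AugmentationDemand

section ClassSizes

variable {S T : Type*} [Fintype S] [DecidableEq S] [DecidableEq T]

theorem exists_isDisjointFamily {F : Finset (Finset T)}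
    (hF : (F : Set (Finset T)).PairwiseDisjoint id) (hne : ∀ Z ∈ F, Z.Nonempty) :
    ∃ X : Fin #F → Finset T, IsDisjointFamily X ∧ univ.biUnion X = F.biUnion id ∧
      ∀ φ : Finset T → ℤ, ∑ j, φ (X j) = ∑ Z ∈ F, φ Z := by
  refine ⟨fun j => F.equivFin.symm j, ⟨fun j => hne _ (F.equivFin.symm j).2, fun i j hij =>
    hF (F.equivFin.symm i).2 (F.equivFin.symm j).2 fun h =>
      hij (F.equivFin.symm.injective (Subtype.ext h))⟩, ?_, fun φ => ?_⟩
  · ext t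
    simp only [mem_biUnion, mem_univ, true_and, id]
    rw [F.equivFin.symm.exists_congr_left]
    simp
  · rw [F.equivFin.symm.sum_comp (fun Z : F => φ Z), sum_coe_sort]

variable {l : ℕ} {P : Fin l → Finset S} {ρ : Finset S → ℕ} {E₀ : Finset (S × T)}
  {p : Finset T → ℤ} {f₁ f₂ : Fin l → ℕ} {g : T → ℕ} {A : Finset (Fin l)}
  {Y : Finset (Option S)} {F : Finset (Finset T)} {cl : S → Fin l}

theorem sum_coverDemand_le_of_upperIneq (hP : IsPartition P)
    (h : ∀ (n : ℕ) (X : Fin n → Finset T), IsDisjointFamily X →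
      UpperIneq ρ E₀ p P f₂ X (A.biUnion P))
    (hY : outside Y = (A.biUnion P)ᶜ) (hF : (F : Set (Finset T)).PairwiseDisjoint id)
    (hne : ∀ Z ∈ F, Z.Nonempty) :
    ∑ Z ∈ F, coverDemand ρ E₀ p Z Y ≤ ∑ α ∈ A, (f₂ α : ℤ) := by
  obtain ⟨X, hX, -, hsum⟩ := exists_isDisjointFamily hF hne
  have hupper := hP.upperIneq_iff.1 (h _ X hX)
  rw [← hY, hsum fun Z => p Z - (ρ (outside Y ∪ nbr E₀ Z) : ℤ)] at hupper
  exact hupper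

theorem sum_demand_le_of_upperIneq (hP : IsPartition P)
    (h : ∀ (n : ℕ) (X : Fin n → Finset T), IsDisjointFamily X →
      UpperIneq ρ E₀ p P f₂ X (A.biUnion P))
    (hY : outside Y = (A.biUnion P)ᶜ) (hnone : none ∉ Y)
    (hF : IsPosFamily (demand ρ E₀ p g) Y F) :
    ∑ Z ∈ F, demand ρ E₀ p g Z Y ≤ ∑ α ∈ A, (f₂ α : ℤ) := by
  have hcover : ∀ Z ∈ F, demand ρ E₀ p g Z Y = coverDemand ρ E₀ p Z Y := fun Z hZ =>
    (demand_cases (hF.pos Z hZ)).resolve_right fun ⟨_, _, hmem, _⟩ => hnone hmem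
  rw [sum_congr rfl hcover]
  exact sum_coverDemand_le_of_upperIneq hP h hY hF.disjoint fun Z hZ =>
    nonempty_of_demand_pos (hF.pos Z hZ)

variable [Fintype T]

theorem sum_coverDemand_add_le_of_lowerIneq (hP : IsPartition P)
    (h : ∀ (n : ℕ) (X : Fin n → Finset T), IsDisjointFamily X →
      LowerIneq ρ E₀ p P f₁ g X (A.biUnion P))
    (hY : outside Y = (A.biUnion P)ᶜ) (hF : (F : Set (Finset T)).PairwiseDisjoint id)
    (hne : ∀ Z ∈ F, Z.Nonempty) :
    ∑ Z ∈ F, coverDemand ρ E₀ p Z Y + ∑ α ∈ Aᶜ, (f₁ α : ℤ) ≤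
      ∑ t ∈ F.biUnion id, (g t : ℤ) +
        ∑ t ∈ (F.biUnion id)ᶜ, (gRestrict E₀ g (outside Y) t : ℤ) := by
  obtain ⟨X, hX, hunion, hsum⟩ := exists_isDisjointFamily hF hne
  have hlower := hP.lowerIneq_iff.1 (h _ X hX)
  rw [← hY, hunion, hsum p,
    hsum fun Z => (ρ (outside Y ∪ nbr E₀ Z) : ℤ) + ∑ t ∈ Z, (g t : ℤ), sum_add_distrib] at hlower
  have hbiUnion : ∑ t ∈ F.biUnion id, (g t : ℤ) = ∑ Z ∈ F, ∑ t ∈ Z, (g t : ℤ) := sum_biUnion hF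
  simp only [coverDemand, sum_sub_distrib]
  linarith

theorem biUnion_filter_not_subset_compl (hF : (F : Set (Finset T)).PairwiseDisjoint id)
    (π : Finset T → Prop) [DecidablePred π] :
    (F.filter fun Z => ¬ π Z).biUnion id ⊆ ((F.filter π).biUnion id)ᶜ := by
  rw [subset_compl_iff_disjoint_left, disjoint_biUnion_left]
  intro Z hZ
  rw [disjoint_biUnion_right]
  intro Z' hZ'
  obtain ⟨hZF, hπ⟩ := mem_filter.1 hZ
  obtain ⟨hZF', hπ'⟩ := mem_filter.1 hZ'
  exact hF hZF hZF' fun h => hπ' (h ▸ hπ)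

theorem sum_demand_add_le_of_lowerIneq (hP : IsPartition P)
    (h : ∀ (n : ℕ) (X : Fin n → Finset T), IsDisjointFamily X →
      LowerIneq ρ E₀ p P f₁ g X (A.biUnion P))
    (hY : outside Y = (A.biUnion P)ᶜ) (hF : IsPosFamily (demand ρ E₀ p g) Y F) :
    ∑ Z ∈ F, demand ρ E₀ p g Z Y + ∑ α ∈ Aᶜ, (f₁ α : ℤ) ≤ ∑ t, (g t : ℤ) := by
  set F₁ := F.filter fun Z => demand ρ E₀ p g Z Y = coverDemand ρ E₀ p Z Y
  set F₂ := F.filter fun Z => ¬ demand ρ E₀ p g Z Y = coverDemand ρ E₀ p Z Y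
  have hF₁ : IsPosFamily (demand ρ E₀ p g) Y F₁ := hF.subset (filter_subset _ _)
  have hF₂ : IsPosFamily (demand ρ E₀ p g) Y F₂ := hF.subset (filter_subset _ _)
  have hsplit : ∑ Z ∈ F, demand ρ E₀ p g Z Y =
      ∑ Z ∈ F₁, coverDemand ρ E₀ p Z Y + ∑ Z ∈ F₂, demand ρ E₀ p g Z Y := by
    rw [← sum_filter_add_sum_filter_not F
      fun Z => demand ρ E₀ p g Z Y = coverDemand ρ E₀ p Z Y]
    congr 1
    exact sum_congr rfl fun Z hZ => (mem_filter.1 hZ).2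
  have hcover := sum_coverDemand_add_le_of_lowerIneq hP h hY hF₁.disjoint fun Z hZ =>
    nonempty_of_demand_pos (hF₁.pos Z hZ)
  have hdegree : ∑ Z ∈ F₂, demand ρ E₀ p g Z Y ≤
      ∑ t ∈ (F₁.biUnion id)ᶜ, ((g t : ℤ) - gRestrict E₀ g (outside Y) t) :=
    calc ∑ Z ∈ F₂, demand ρ E₀ p g Z Y
        ≤ ∑ Z ∈ F₂, ∑ t ∈ Z, ((g t : ℤ) - gRestrict E₀ g (outside Y) t) := by
          refine sum_le_sum fun Z hZ => ?_
          obtain ⟨t, rfl, -, heq⟩ := (demand_cases (hF₂.pos Z hZ)).resolve_left (mem_filter.1 hZ).2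
          rw [heq, sum_singleton]
          exact sub_le_sub_left (Nat.cast_le.2 (min_le_left _ _)) _
      _ = ∑ t ∈ F₂.biUnion id, ((g t : ℤ) - gRestrict E₀ g (outside Y) t) :=
          (sum_biUnion hF₂.disjoint).symm
      _ ≤ ∑ t ∈ (F₁.biUnion id)ᶜ, ((g t : ℤ) - gRestrict E₀ g (outside Y) t) := by
          exact sum_le_sum_of_subset_of_nonneg (biUnion_filter_not_subset_compl hF.disjoint _)
            fun t _ _ => sub_nonneg.2 (Nat.cast_le.2 (min_le_right _ _))
  rw [sum_sub_distrib] at hdegree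
  rw [hsplit, ← sum_add_sum_compl (F₁.biUnion id) fun t => (g t : ℤ)]
  linarith

theorem outside_classUnion (hcl : ∀ s α, s ∈ P α ↔ cl s = α) (B : Finset (Option (Fin l))) :
    outside (classUnion (Option.map cl) B) = ((eraseNone B).biUnion P)ᶜ := by
  ext s
  simp [mem_outside, mem_classUnion, hcl]

theorem eraseNone_compl {ι : Type*} [Fintype ι] [DecidableEq ι] (B : Finset (Option ι)) :
    eraseNone Bᶜ = (eraseNone B)ᶜ := by
  ext; simp

theorem maxDemand_classUnion_le (hq : IsDemand (demand ρ E₀ p g)) (hP : IsPartition P)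
    (hcl : ∀ s α, s ∈ P α ↔ cl s = α)
    (h : ∀ (n : ℕ) (X : Fin n → Finset T) (S₀ : Finset S), IsDisjointFamily X →
      IsUnionOfParts P S₀ → UpperIneq ρ E₀ p P f₂ X S₀)
    {B : Finset (Option (Fin l))} (hnone : none ∉ B) :
    maxDemand (demand ρ E₀ p g) univ (classUnion (Option.map cl) B) ≤
      ∑ α ∈ eraseNone B, (f₂ α : ℤ) := by
  obtain ⟨F, hF, -, hsum⟩ := hq.exists_sum_eq_maxDemand univ (classUnion (Option.map cl) B)
  rw [← hsum]
  exact sum_demand_le_of_upperIneq hP (fun n X hX => h n X _ hX ⟨_, rfl⟩)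
    (outside_classUnion hcl B) (by simpa [mem_classUnion] using hnone) hF

theorem maxDemand_classUnion_add_le (hq : IsDemand (demand ρ E₀ p g)) (hP : IsPartition P)
    (hcl : ∀ s α, s ∈ P α ↔ cl s = α)
    (h : ∀ (n : ℕ) (X : Fin n → Finset T) (S₀ : Finset S), IsDisjointFamily X →
      IsUnionOfParts P S₀ → LowerIneq ρ E₀ p P f₁ g X S₀) (B : Finset (Option (Fin l))) :
    maxDemand (demand ρ E₀ p g) univ (classUnion (Option.map cl) B) +
      ∑ α ∈ eraseNone Bᶜ, (f₁ α : ℤ) ≤ ∑ t, (g t : ℤ) := by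
  obtain ⟨F, hF, -, hsum⟩ := hq.exists_sum_eq_maxDemand univ (classUnion (Option.map cl) B)
  rw [← hsum, eraseNone_compl]
  exact sum_demand_add_le_of_lowerIneq hP (fun n X hX => h n X _ hX ⟨_, rfl⟩)
    (outside_classUnion hcl B) hF

theorem exists_fits (hq : IsDemand (demand ρ E₀ p g)) (hP : IsPartition P)
    (hcl : ∀ s α, s ∈ P α ↔ cl s = α) (hf : ∀ α, f₁ α ≤ f₂ α)
    (h : ∀ (n : ℕ) (X : Fin n → Finset T) (S₀ : Finset S), IsDisjointFamily X →
      IsUnionOfParts P S₀ → LowerIneq ρ E₀ p P f₁ g X S₀ ∧ UpperIneq ρ E₀ p P f₂ X S₀) :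
    ∃ m : Option (Fin l) → ℕ, (∀ α, f₁ α ≤ m (some α) ∧ m (some α) ≤ f₂ α) ∧
      ∑ i, m i = ∑ t, g t ∧ Fits (demand ρ E₀ p g) (Option.map cl) m := by
  set lo : Option (Fin l) → ℕ := Option.elim' 0 f₁
  set hi : Option (Fin l) → ℕ := Option.elim' (∑ t, g t) f₂
  have hlo : ∀ B, maxDemand (demand ρ E₀ p g) univ (classUnion (Option.map cl) B) +
      ∑ i ∈ Bᶜ, (lo i : ℤ) ≤ ((∑ t, g t : ℕ) : ℤ) := by
    intro B
    have hlower := maxDemand_classUnion_add_le hq hP hcl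
      (fun n X S₀ hX hS₀ => (h n X S₀ hX hS₀).1) B
    rw [← Nat.cast_sum, ← sum_eraseNone]
    exact_mod_cast hlower
  have hhi : ∀ B, maxDemand (demand ρ E₀ p g) univ (classUnion (Option.map cl) B) ≤
      ∑ i ∈ B, (hi i : ℤ) := by
    intro B
    rw [← Nat.cast_sum]
    by_cases hnone : none ∈ B
    · have hG : ∑ t, g t ≤ ∑ i ∈ B, hi i := single_le_sum_of_canonicallyOrdered (f := hi) hnone
      have hpos : 0 ≤ ∑ i ∈ Bᶜ, (lo i : ℤ) := by positivity
      linarith [hlo B, Nat.cast_le (α := ℤ).2 hG]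
    · have heraseNone : ∑ α ∈ eraseNone B, f₂ α ≤ ∑ i ∈ B, hi i := by
        rw [sum_eraseNone]
        exact sum_le_sum fun i _ => by cases i <;> simp [hi]
      exact (maxDemand_classUnion_le hq hP hcl (fun n X S₀ hX hS₀ => (h n X S₀ hX hS₀).2)
        hnone).trans (by exact_mod_cast heraseNone)
  have hle : lo ≤ hi := fun i => by cases i <;> simp [lo, hi, hf]
  have hG : ∑ t, g t ≤ ∑ i, hi i := single_le_sum_of_canonicallyOrdered (f := hi) (mem_univ none)
  obtain ⟨m, hlom, hmhi, hsum, hfits⟩ :=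
    (hq.supermodular_maxDemand univ (Option.map cl)).exists_dominating maxDemand_nonneg hle hG hhi
      hlo
  exact ⟨m, fun α => ⟨hlom (some α), hmhi (some α)⟩, hsum, hfits⟩

end ClassSizes

section Extraction

section Multiplicities

variable {S T : Type*} [Fintype S] [DecidableEq S] [DecidableEq T] {ρ : Finset S → ℕ}
  {E₀ : Finset (S × T)} {p : Finset T → ℤ} {g : T → ℕ} {x : T → Option S → ℕ}

theorem IsCovering.le_sum (hx : IsCovering (demand ρ E₀ p g) x) (t : T) :
    g t ≤ ∑ k, x t k := by
  have hdemand := (degreeDemand_le_demand t (mem_univ none)).trans (hx {t} univ)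
  rw [degreeDemand_univ, sum_singleton] at hdemand
  exact_mod_cast hdemand

theorem IsCovering.apply_some_le (hx : IsCovering (demand ρ E₀ p g) x) {t : T}
    (hg : ∑ k, x t k = g t) (s : S) : x t (some s) ≤ #({s} \ nbr E₀ {t}) := by
  have houtside : outside (univ.erase (some s)) = {s} := by
    ext s'
    simp [mem_outside]
  have hdemand := (degreeDemand_le_demand t (mem_erase.2 ⟨(Option.some_ne_none s).symm,
    mem_univ none⟩)).trans (hx {t} (univ.erase (some s)))
  have hsum := add_sum_erase univ (x t) (mem_univ (some s))
  rw [degreeDemand, houtside, sum_singleton] at hdemand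
  zify at hsum hg ⊢
  linarith

end Multiplicities

variable {S T : Type*} [Fintype S] [Fintype T]

/-- The edges with positive multiplicity; those at the sink `none` are dropped. -/
def support (x : T → Option S → ℕ) : Finset (S × T) :=
  univ.filter fun e => 0 < x e.2 (some e.1)

variable {x : T → Option S → ℕ}

theorem mem_support {s : S} {t : T} : (s, t) ∈ support x ↔ 0 < x t (some s) := by
  simp [support]

theorem edgesBetween_support [DecidableEq S] [DecidableEq T] (hx : ∀ t s, x t (some s) ≤ 1)
    (X : Finset T) (Z : Finset S) :
    edgesBetween (support x) X Z = ∑ t ∈ X, ∑ s ∈ Z, x t (some s) := by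
  rw [edgesBetween_eq_sum]
  refine sum_congr rfl fun t _ => sum_congr rfl fun s _ => ?_
  have hone := hx t s
  split_ifs with h <;> rw [mem_support] at h <;> omega

theorem degT_support_le [DecidableEq T] (hx : ∀ t s, x t (some s) ≤ 1) (t : T) :
    degT (support x) t ≤ ∑ k, x t k := by
  classical
  rw [← sum_singleton (degT (support x)) t, sum_degT, edgesBetween_support hx, sum_singleton,
    Fintype.sum_option]
  exact Nat.le_add_left _ _

theorem sum_degS_support [DecidableEq S] {l : ℕ} {P : Fin l → Finset S} {cl : S → Fin l}
    (hx : ∀ t s, x t (some s) ≤ 1) (hcl : ∀ s α, s ∈ P α ↔ cl s = α) (α : Fin l) :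
    ∑ s ∈ P α, degS (support x) s =
      ∑ t, ∑ k ∈ classUnion (Option.map cl) {some α}, x t k := by
  classical
  have hclass : classUnion (Option.map cl) {some α} = (P α).map Function.Embedding.some := by
    ext k
    cases k <;> simp [mem_classUnion, hcl]
  simp_rw [sum_degS, edgesBetween_support hx, hclass, sum_map, Function.Embedding.some_apply]

variable [DecidableEq S] [DecidableEq T] {ρ : Finset S → ℕ} {E₀ : Finset (S × T)}
  {p : Finset T → ℤ} {g : T → ℕ}

theorem IsCovering.covers_support_union (hx : IsCovering (demand ρ E₀ p g) x) :
    Covers ρ (support x ∪ E₀) p := by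
  intro X hX
  set Y := (nbr (support x) X)ᶜ.map Function.Embedding.some with hY
  have houtside : outside Y = nbr (support x) X := by
    ext s
    simp [mem_outside, hY]
  have hzero : ∑ t ∈ X, ∑ k ∈ Y, (x t k : ℤ) = 0 := by
    rw [hY]
    refine sum_eq_zero fun t ht => sum_map .. |>.trans (sum_eq_zero fun s hs => ?_)
    by_contra hne
    exact mem_compl.1 hs (mem_nbr.2 ⟨t, ht, mem_support.2
      (by simpa only [Function.Embedding.some_apply, Nat.cast_ne_zero, Nat.pos_iff_ne_zero]
        using hne)⟩)
  have hdemand := (coverDemand_le_demand hX Y).trans (hx X Y)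
  rw [hzero, coverDemand, houtside, ← nbr_union_left] at hdemand
  linarith

theorem IsCovering.sum_eq {I : Type*} [Fintype I] [DecidableEq I] {c : Option S → I} {m : I → ℕ}
    (hx : IsCovering (demand ρ E₀ p g) x)
    (hxm : ∀ A, ∑ t, ∑ k ∈ classUnion c A, (x t k : ℤ) ≤ ∑ i ∈ A, (m i : ℤ))
    (hsum : ∑ i, m i = ∑ t, g t) :
    (∀ t, ∑ k, x t k = g t) ∧ ∀ i, ∑ t, ∑ k ∈ classUnion c {i}, x t k = m i := by
  have hle := hx.le_sum
  have hclass : ∀ i, ∑ t, ∑ k ∈ classUnion c {i}, x t k ≤ m i := fun i => by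
    simpa only [sum_singleton, ← Nat.cast_sum, Nat.cast_le] using hxm {i}
  have hfiber : ∑ i, ∑ t, ∑ k ∈ classUnion c {i}, x t k = ∑ t, ∑ k, x t k := by
    rw [sum_comm]
    simp only [classUnion, mem_singleton, sum_fiberwise]
  have hge := sum_le_sum fun t (_ : t ∈ univ) => hle t
  have hge' := sum_le_sum fun i (_ : i ∈ univ) => hclass i
  exact ⟨fun t => ((sum_eq_sum_iff_of_le fun t _ => hle t).1 (by omega) t (mem_univ t)).symm,
    fun i => (sum_eq_sum_iff_of_le fun i _ => hclass i).1 (by omega) i (mem_univ i)⟩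

theorem exists_isGoodAugmentation {l : ℕ} {P : Fin l → Finset S} {f₁ f₂ : Fin l → ℕ}
    (hρ : IsRankFunction ρ) (hp : PosIntersectingSupermodular p)
    (hP : IsPartition P) (hf : ∀ α, f₁ α ≤ f₂ α)
    (h : ∀ (n : ℕ) (X : Fin n → Finset T) (S₀ : Finset S), IsDisjointFamily X →
      IsUnionOfParts P S₀ → LowerIneq ρ E₀ p P f₁ g X S₀ ∧ UpperIneq ρ E₀ p P f₂ X S₀) :
    ∃ E, IsGoodAugmentation ρ E₀ p P f₁ f₂ g E := by
  have hq := isDemand_demand hρ hp E₀ g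
  obtain ⟨cl, hcl⟩ := hP.exists_eq_fibers
  obtain ⟨m, hmf, hsum, hm⟩ := exists_fits hq hP hcl hf h
  have hfull : ∑ i, (m i : ℤ) ≤ ∑ t, demand ρ E₀ p g {t} univ :=
    calc ∑ i, (m i : ℤ) = ∑ t, degreeDemand E₀ g t univ := by
          simp only [degreeDemand_univ, ← Nat.cast_sum, hsum]
      _ ≤ ∑ t, demand ρ E₀ p g {t} univ :=
          sum_le_sum fun t _ => degreeDemand_le_demand t (mem_univ none)
  obtain ⟨x, hx, hxm⟩ := hq.exists_covering hm hfull
  obtain ⟨hg, hclass⟩ := hx.sum_eq hxm hsum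
  have hnbr : ∀ t s, x t (some s) ≤ #({s} \ nbr E₀ {t}) := fun t => hx.apply_some_le (hg t)
  have hone : ∀ t s, x t (some s) ≤ 1 := fun t s =>
    (hnbr t s).trans ((card_le_card sdiff_subset).trans_eq (card_singleton s))
  have hdisj : Disjoint (support x) E₀ := by
    rw [disjoint_left]
    rintro ⟨s, t⟩ hs hs₀
    have hzero := hnbr t s
    rw [sdiff_eq_empty_iff_subset.2 (singleton_subset_iff.2 (mem_nbr_singleton.2 hs₀)),
      card_empty] at hzero
    exact (mem_support.1 hs).not_ge hzero
  refine ⟨support x, ⟨hdisj, hx.covers_support_union⟩, fun α => ?_, fun t => ?_⟩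
  · rw [sum_degS_support hone hcl, hclass]
    exact hmf α
  · exact (degT_support_le hone t).trans_eq (hg t)

end Extraction

theorem LowerIneq.sum_le_sum_gRestrict {S T : Type*} [Fintype S] [DecidableEq S] [Fintype T]
    [DecidableEq T] {ρ : Finset S → ℕ} {E₀ : Finset (S × T)} {p : Finset T → ℤ} {l : ℕ}
    {P : Fin l → Finset S} {f₁ : Fin l → ℕ} {g : T → ℕ} {X : Fin 0 → Finset T} {S₀ : Finset S}
    (h : LowerIneq ρ E₀ p P f₁ g X S₀) :
    ∑ α with P α ⊆ S₀ᶜ, f₁ α ≤ ∑ t, gRestrict E₀ g S₀ᶜ t := by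
  simp only [LowerIneq, univ_eq_empty, sum_empty, biUnion_empty, sdiff_empty] at h
  zify
  linarith

end BipCover

theorem theorem5p3_general {S T : Type*} [Fintype S] [DecidableEq S] [Fintype T] [DecidableEq T]
    {ρ : Finset S → ℕ} (hρ : BipCover.IsRankFunction ρ) (E₀ : Finset (S × T)) {p : Finset T → ℤ}
    (hp : BipCover.PosIntersectingSupermodular p) {l : ℕ} {P : Fin l → Finset S}
    (hP : BipCover.IsPartition P) {f₁ f₂ : Fin l → ℕ} (hf : ∀ α, f₁ α ≤ f₂ α) (g : T → ℕ) :
    (∃ E : Finset (S × T), BipCover.IsGoodAugmentation ρ E₀ p P f₁ f₂ g E) ↔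
      ∀ (n : ℕ) (X : Fin n → Finset T) (S₀ : Finset S),
        BipCover.IsDisjointFamily X → BipCover.IsUnionOfParts P S₀ →
          BipCover.LowerIneq ρ E₀ p P f₁ g X S₀ ∧ BipCover.UpperIneq ρ E₀ p P f₂ X S₀ :=
  ⟨fun ⟨_, hE⟩ _ _ _ hX hS₀ => ⟨hE.lowerIneq hρ hP hX hS₀, hE.upperIneq hρ hP hX hS₀⟩,
    BipCover.exists_isGoodAugmentation hρ hp hP hf⟩

theorem theorem5p3 {S T : Type*} [Fintype S] [DecidableEq S] [Fintype T] [DecidableEq T]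
    (E₀ : Finset (S × T)) (p : Finset T → ℤ)
    (hp : BipCover.PosIntersectingSupermodular p)
    (hpS : ∀ X : Finset T, p X ≤ (Fintype.card S : ℤ))
    {l : ℕ} (P : Fin l → Finset S) (hP : BipCover.IsPartition P)
    (f₁ f₂ : Fin l → ℕ) (hf : ∀ α, f₁ α ≤ f₂ α) (g : T → ℕ) :
    -- the characterization
    ((∃ E : Finset (S × T), BipCover.IsGoodAugmentation Finset.card E₀ p P f₁ f₂ g E) ↔
      ∀ (n : ℕ) (X : Fin n → Finset T) (S₀ : Finset S),
        BipCover.IsDisjointFamily X → BipCover.IsUnionOfParts P S₀ →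
          BipCover.LowerIneq Finset.card E₀ p P f₁ g X S₀ ∧
          BipCover.UpperIneq Finset.card E₀ p P f₂ X S₀) ∧
    -- the particular case `n = 0` of the first inequality
    (∀ (X : Fin 0 → Finset T) (S₀ : Finset S),
      BipCover.LowerIneq Finset.card E₀ p P f₁ g X S₀ →
        ∑ α with P α ⊆ S₀ᶜ, f₁ α ≤ ∑ t, BipCover.gRestrict E₀ g S₀ᶜ t) ∧
    -- the matroidal version
    (∀ M : Matroid S, M.E = Set.univ →
      ((∃ E : Finset (S × T),
          BipCover.IsGoodAugmentation (BipCover.rank M) E₀ p P f₁ f₂ g E) ↔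
        ∀ (n : ℕ) (X : Fin n → Finset T) (S₀ : Finset S),
          BipCover.IsDisjointFamily X → BipCover.IsUnionOfParts P S₀ →
            BipCover.LowerIneq (BipCover.rank M) E₀ p P f₁ g X S₀ ∧
            BipCover.UpperIneq (BipCover.rank M) E₀ p P f₂ X S₀)) :=
  ⟨theorem5p3_general BipCover.isRankFunction_card E₀ hp hP hf g,
    fun _ _ h => h.sum_le_sum_gRestrict,
    fun M _ => theorem5p3_general (BipCover.isRankFunction_rank M) E₀ hp hP hf g⟩
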